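/- Let $\mathbb{F}_q$ be a finite field with $q$ elements, let $\mathcal{M}$ be the set of monic polynomials in $\mathbb{F}_q[T]$, and write $|A| = q^{\deg A}$ for $A \neq 0$. Let $\Lambda(A) = \log|P|$ if $A = P^e$ for a monic irreducible $P$ and an integer $e \geq 1$, and $\Lambda(A) = 0$ otherwise. Let $X \geq 1$ be an integer and let $u : \mathbb{R} \to \mathbb{R}$ be a non-negative $C^\infty$-function with support in $[e, e^{1+q^{-X}}]$, normalised so that $v(0) = 1$, where $v(x) = \int_x^\infty u(t)\,dt$. For $y \in \mathbb{C}\setminus\{0\}$ with $\arg(y) \neq \pi$ put $$E_1(y) = \int_y^{y+\infty} \frac{e^{-w}}{w}\,dw = \int_0^\infty \frac{e^{-(y+t)}}{y+t}\,dt ,$$ and for $z \in \mathbb{C}\setminus\{0\}$ with $\arg(z) \neq \pi$ put $$U(z) = \int_0^\infty u(x)\, E_1(z \log x)\,dx .$$ Both integrals converge absolutely. Let $\chi$ be a primitive Dirichlet character of modulus $R \in \mathcal{M}\setminus\{1\}$. Its $L$-function $L(s,\chi)$ is the entire function which for $\operatorname{Re}(s) > 1$ is given by the absolutely convergent series $\sum_{A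 \in \mathcal{M}} \chi(A)|A|^{-s}$. Then for all $s \in \mathbb{C}$ we have $$L(s,\chi) = P_X(s,\chi)\, Z_X(s,\chi),$$ where $$P_X(s,\chi) = \exp\Bigg(\sum_{\substack{A \in \mathcal{M} \\ 1 \leq \deg A \leq X}} \frac{\chi(A)\Lambda(A)}{|A|^s \log|A|}\Bigg)$$ and $$Z_X(s,\chi) = \exp\Bigg(-\sum_{\rho} U\big((s-\rho)(\log q)X\big)\Bigg),$$ the sum being over all zeros $\rho$ of $L(s,\chi)$ in $\mathbb{C}$, counted with multiplicity. The sum converges absolutely for every $s$ such that $s \neq \rho$ and $\arg(s-\rho) \neq \pi$ for all zeros $\rho$. If $s = \rho$ or $\arg(s-\rho) = \pi$ for some zero $\rho$, then $Z_X(s,\chi)$ is defined to be $\lim_{s_0 \to s} Z_X(s_0,\chi)$, where $s_0$ runs through the points not of this kind; every such $s$ is a limit of such points, and the limit exists. -/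

import Mathlib

open scoped Polynomial Topology ContDiff

noncomputable section

namespace HybridEH

/-! ### Arithmetic of `𝔽_q[T]` -/

section Arithmetic

variable {F : Type*} [Field F] [Fintype F]

/-- A Dirichlet character modulo `R`: a multiplicative character of `𝔽_q[T] / (R)`, extended by
zero to the residue classes that are not invertible. -/
abbrev DirichletChar (R : F[X]) : Type _ := MulChar (F[X] ⧸ Ideal.span {R}) ℂ

/-- The value `χ(A)` of a Dirichlet character at a polynomial. -/
def DirichletChar.val {R : F[X]} (χ : DirichletChar R) (A : F[X]) : ℂ :=
  χ (Ideal.Quotient.mk (Ideal.span {R}) A)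

open Classical in
/-- The monic divisor `S` of `R` is an induced modulus of `χ`: there is a character `χ₁` modulo `S`
with `χ(A) = χ₁(A)` if `(A, R) = 1` and `χ(A) = 0` otherwise. -/
def DirichletChar.IsInducedModulus {R : F[X]} (χ : DirichletChar R) (S : F[X]) : Prop :=
  S.Monic ∧ S ∣ R ∧ ∃ χ₁ : DirichletChar S, ∀ A : F[X],
    DirichletChar.val χ A = if IsCoprime A R then DirichletChar.val χ₁ A else 0

/-- `χ` is primitive: it has no induced modulus of degree strictly smaller than that of `R`. -/
def DirichletChar.IsPrimitive {R : F[X]} (χ : DirichletChar R) : Prop :=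
  ¬ ∃ S : F[X], DirichletChar.IsInducedModulus χ S ∧ S.natDegree < R.natDegree

/-- The absolute value `|A| = q ^ deg A` (and `|0| = 0`), as a real number. -/
def absNorm (A : F[X]) : ℝ := ((Polynomial.cardPowDegree A : ℤ) : ℝ)

open Classical in
/-- The von Mangoldt function: `Λ(A) = log |P|` if `A = P ^ e` with `P` a monic prime and `e ≥ 1`,
and `Λ(A) = 0` otherwise. The prime `P` is unique when it exists. -/
def vonMangoldt (A : F[X]) : ℝ :=
  if h : ∃ P : F[X], P.Monic ∧ Irreducible P ∧ ∃ e : ℕ, 1 ≤ e ∧ A = P ^ e then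
    Real.log (absNorm h.choose)
  else 0

theorem finite_monic_natDegree_le (F : Type*) [Field F] [Fintype F] (X : ℕ) :
    {A : F[X] | A.Monic ∧ A.natDegree ≤ X}.Finite := by
  have : Finite (Polynomial.degreeLT F (X + 1)) :=
    Finite.of_equiv _ (Polynomial.degreeLTEquiv F (X + 1)).symm.toEquiv
  refine (Set.toFinite (Polynomial.degreeLT F (X + 1) : Set F[X])).subset ?_
  rintro A ⟨-, hA⟩
  rw [SetLike.mem_coe, Polynomial.mem_degreeLT]
  exact lt_of_le_of_lt Polynomial.degree_le_natDegree (by exact_mod_cast Nat.lt_succ_of_le hA)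

/-- The finite set of monic polynomials of degree at most `X`. -/
def monicLE (F : Type*) [Field F] [Fintype F] (X : ℕ) : Finset F[X] :=
  (finite_monic_natDegree_le F X).toFinset

/-- `L` is the holomorphic continuation to `ℂ` of the Dirichlet series
`∑ χ(A) / |A| ^ s` over monic `A`, `Re s > 1`. There is at most one such `L`. -/
def IsLFunction {R : F[X]} (χ : DirichletChar R) (L : ℂ → ℂ) : Prop :=
  Differentiable ℂ L ∧ ∀ s : ℂ, 1 < s.re →
    HasSum (fun A : {A : F[X] // A.Monic} =>
      DirichletChar.val χ A.1 / (absNorm A.1 : ℂ) ^ s) (L s)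

/-- The Dirichlet `L`-function `L(s, χ)`: the holomorphic continuation to `ℂ` of the Dirichlet
series (it exists for all nontrivial `χ`). -/
def LFunction {R : F[X]} (χ : DirichletChar R) : ℂ → ℂ :=
  Classical.epsilon (IsLFunction χ)

/-- `P_X(s, χ)`, the exponential of the sum of `χ(A) Λ(A) / (|A| ^ s log |A|)` over monic `A` with
`deg A ≤ X`. (The term `A = 1` is zero.) -/
def eulerProd {R : F[X]} (χ : DirichletChar R) (X : ℕ) (s : ℂ) : ℂ :=
  Complex.exp (∑ A ∈ monicLE F X,
    DirichletChar.val χ A * (vonMangoldt A : ℂ) /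
      ((absNorm A : ℂ) ^ s * (Real.log (absNorm A) : ℂ)))

end Arithmetic

/-! ### The weight and the exponential integral -/

/-- `v(x) = ∫_x^∞ u(t) dt`. -/
def vWeight (u : ℝ → ℝ) (x : ℝ) : ℝ := ∫ t in Set.Ioi x, u t

/-- `E₁(y) = ∫_y^{y + ∞} e^{-w} / w dw`, along the horizontal ray from `y` to the right. -/
def E1 (y : ℂ) : ℂ := ∫ t in Set.Ioi (0 : ℝ), Complex.exp (-(y + t)) / (y + t)

/-- `U(z) = ∫_0^∞ u(x) E₁(z log x) dx`. -/
def UWeight (u : ℝ → ℝ) (z : ℂ) : ℂ :=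
  ∫ x in Set.Ioi (0 : ℝ), (u x : ℂ) * E1 (z * (Real.log x : ℂ))

/-! ### The product over zeros -/

section Zeros

variable {F : Type*} [Field F] [Fintype F]

/-- The type of all zeros `ρ` of `L(s, χ)` (each listed once). -/
abbrev LZero {R : F[X]} (χ : DirichletChar R) : Type := {ρ : ℂ // LFunction χ ρ = 0}

/-- The contribution of the zero `ρ`, repeated according to its multiplicity, to the sum over
zeros: `m(ρ) U((s - ρ) (log q) X)`. -/
def zeroTerm {R : F[X]} (χ : DirichletChar R) (X : ℕ) (u : ℝ → ℝ) (s : ℂ) (ρ : LZero χ) : ℂ :=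
  (analyticOrderNatAt (LFunction χ) ρ.1 : ℂ) *
    UWeight u ((s - ρ.1) * (Real.log (Fintype.card F) : ℂ) * (X : ℂ))

/-- `s` is regular: `s ≠ ρ` and `arg (s - ρ) ≠ π` for every zero `ρ`. -/
def IsRegular {R : F[X]} (χ : DirichletChar R) (s : ℂ) : Prop :=
  ∀ ρ : LZero χ, s ≠ ρ.1 ∧ Complex.arg (s - ρ.1) ≠ Real.pi

/-- `exp (- ∑_ρ U((s - ρ) (log q) X))`, meaningful for regular `s`. -/
def hadamardRaw {R : F[X]} (χ : DirichletChar R) (X : ℕ) (u : ℝ → ℝ) (s : ℂ) : ℂ :=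
  Complex.exp (-∑' ρ : LZero χ, zeroTerm χ X u s ρ)

open Classical in
/-- `Z_X(s, χ)`: given by the exponential of the sum over zeros when `s` is regular, and otherwise
by the limit of that expression at regular points `s₀ → s`. -/
def hadamardProd {R : F[X]} (χ : DirichletChar R) (X : ℕ) (u : ℝ → ℝ) (s : ℂ) : ℂ :=
  if IsRegular χ s then hadamardRaw χ X u s
  else Filter.limUnder (𝓝[{s₀ | IsRegular χ s₀}] s) (hadamardRaw χ X u)

end Zeros

end HybridEH

end

open HybridEH

/-! Since `χ` is nontrivial, its sums over monic polynomials of degree at least `deg R` vanish, so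
`L(s, χ)` is a polynomial in `q^{-s}` with constant term 1 (`isLFunction_LPoly`), and `L(s, χ) = ∏
(1 - q^{-s}/β)` over its roots `β` (`LFunction_eq_prod`). The zeros are therefore finitely many
vertical lattices, one for each distinct `β`, with spacing `2πi / log q`, and the formula reduces to
one identity per root.

That identity comes from Poisson summation. With `K(t) = (1 - v(e^t))/t`, the function `U` is the
Laplace transform of `K` on the right half plane. Hence `∑_k U((z + 2πik)X)` equals `∑_n K(n/X)/X ·
e^{-zn}`. The kernel `K` vanishes up to 1 and is `1/t` from `1 + δ` on, and `δX ≤ 1`, so no integer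
falls inside the transition range. The sum is exactly `∑_{n > X} e^{-zn}/n`, the tail of `-log(1 -
e^{-z})`. Exponentiation gives `(1 - e^{-z}) exp(∑_{n ≤ X} e^{-zn}/n)`, and the identity theorem
extends this to the plane minus the cuts (`exp_neg_tsum_UWeight_translate`). For `e^{-z} = q^{-s}/β`
the first factors multiply to `L(s, χ)`.

The remaining exponentials are the inverse of `P_X`. The identity `∑_{D ∣ A} Λ(D) = log |A|` is
Newton's recursion for the coefficients of `L`, so the sums of `χ(A)Λ(A)` over degree `n` are `-log
q · ∑ β^{-n}` (`charMangoldtSum_eq`, `eulerProd_eq`). Since `L/P_X` is entire, the limits at the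
excluded points exist. -/

/-! ### The exponential integral on the slit plane. -/

theorem add_ofReal_mem_slitPlane {y : ℂ} (hy : y ∈ Complex.slitPlane) {t : ℝ} (ht : 0 ≤ t) :
    y + t ∈ Complex.slitPlane := by
  rw [Complex.mem_slitPlane_iff] at hy ⊢
  rcases hy with h | h
  · left; simp; linarith
  · right; simpa using h

/-- If `y' + t` were too small, then `-t` would lie in a ball around `y` that avoids the cut. The
bound is uniform in `y'`, as differentiation under the integral sign requires. -/
theorem exists_le_norm_add_ofReal {y : ℂ} (hy : y ∈ Complex.slitPlane) :
    ∃ ε > 0, ∀ y' ∈ Metric.ball y ε, y' ∈ Complex.slitPlane ∧ ∀ t : ℝ, 0 ≤ t → ε ≤ ‖y' + t‖ := by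
  obtain ⟨δ, hδ, hball⟩ := Metric.isOpen_iff.1 Complex.isOpen_slitPlane y hy
  refine ⟨δ / 2, by positivity, fun y' hy' => ⟨hball (Metric.ball_subset_ball (by linarith) hy'),
    fun t ht => ?_⟩⟩
  by_contra! h
  have h1 : (-t : ℂ) ∈ Metric.ball y δ := by
    rw [Metric.mem_ball, dist_eq_norm] at hy' ⊢
    calc ‖(-t : ℂ) - y‖ = ‖(y' - y) - (y' + t)‖ := by congr 1; ring
      _ ≤ ‖y' - y‖ + ‖y' + t‖ := norm_sub_le _ _
      _ < δ := by linarith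
  have h2 := hball h1
  rw [Complex.mem_slitPlane_iff] at h2
  simp at h2
  linarith

theorem norm_exp_neg_add_div_pow_le {y : ℂ} {ε t : ℝ} (hε : 0 < ε) (h : ε ≤ ‖y + t‖) (n : ℕ) :
    ‖Complex.exp (-(y + t)) / (y + t) ^ n‖ ≤ Real.exp (-y.re) / ε ^ n * Real.exp (-t) := by
  rw [norm_div, norm_pow, Complex.norm_exp, div_mul_eq_mul_div, ← Real.exp_add]
  have : (-(y + t)).re = -y.re + -t := by simp; ring
  rw [this]
  gcongr

theorem integrableOn_exp_neg_add_div_pow {y : ℂ} (hy : y ∈ Complex.slitPlane) (n : ℕ) :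
    MeasureTheory.IntegrableOn (fun t : ℝ => Complex.exp (-(y + t)) / (y + t) ^ n) (Set.Ioi 0) := by
  obtain ⟨ε, hε, h⟩ := exists_le_norm_add_ofReal hy
  have h := (h y (Metric.mem_ball_self hε)).2
  have hint : MeasureTheory.IntegrableOn
      (fun t : ℝ => Real.exp (-y.re) / ε ^ n * Real.exp (-t)) (Set.Ioi 0) :=
    (integrableOn_exp_neg_Ioi 0).const_mul _
  refine MeasureTheory.Integrable.mono' hint ?_ ?_
  · refine ContinuousOn.aestronglyMeasurable ?_ measurableSet_Ioi
    refine ContinuousOn.div (by fun_prop) (by fun_prop) fun t ht => pow_ne_zero _ ?_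
    exact Complex.slitPlane_ne_zero (add_ofReal_mem_slitPlane hy (le_of_lt ht))
  · refine (MeasureTheory.ae_restrict_iff' measurableSet_Ioi).2 (Filter.Eventually.of_forall ?_)
    intro t ht
    exact norm_exp_neg_add_div_pow_le hε (h t (le_of_lt ht)) n

theorem tendsto_exp_neg_add_div_atTop (y : ℂ) :
    Filter.Tendsto (fun t : ℝ => Complex.exp (-(y + t)) / (y + t)) Filter.atTop (𝓝 0) := by
  have h1 : Filter.Tendsto (fun t : ℝ => Real.exp (-y.re) * Real.exp (-t))
      Filter.atTop (𝓝 0) := by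
    simpa using (Real.tendsto_exp_neg_atTop_nhds_zero).const_mul (Real.exp (-y.re))
  refine squeeze_zero_norm' ?_ h1
  filter_upwards [Filter.eventually_ge_atTop (1 - y.re), Filter.eventually_ge_atTop 0] with t ht _
  have h2 : (1:ℝ) ≤ ‖y + t‖ := by
    refine le_trans ?_ (Complex.re_le_norm _)
    simp; linarith
  simpa using norm_exp_neg_add_div_pow_le one_pos h2 1

theorem hasDerivAt_exp_neg_div {w : ℂ} (hw : w ≠ 0) :
    HasDerivAt (fun w => Complex.exp (-w) / w)
      (-(Complex.exp (-w) / w ^ 1) - Complex.exp (-w) / w ^ 2) w := by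
  have h := ((hasDerivAt_neg w).cexp).div (hasDerivAt_id w) hw
  convert! h using 1
  simp only [id]
  field_simp

/-- The integrand is the `t`-derivative of `e^{-(y+t)}/(y+t)`. The identity serves twice: it
evaluates the derivative of `E1`, and it is the integration by parts behind `norm_E1_sub_le`. -/
theorem integral_deriv_exp_neg_add_div {y : ℂ} (hy : y ∈ Complex.slitPlane) :
    ∫ t in Set.Ioi (0:ℝ), (-(Complex.exp (-(y + t)) / (y + t) ^ 1)
      - Complex.exp (-(y + t)) / (y + t) ^ 2) = -(Complex.exp (-y) / y) := by
  have h := MeasureTheory.integral_Ioi_of_hasDerivAt_of_tendsto'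
    (f := fun t : ℝ => Complex.exp (-(y + t)) / (y + t)) (a := 0) (m := 0)
    (f' := fun t : ℝ => (-(Complex.exp (-(y + t)) / (y + t) ^ 1)
      - Complex.exp (-(y + t)) / (y + t) ^ 2)) ?_ ?_ (tendsto_exp_neg_add_div_atTop y)
  · simpa using h
  · intro t ht
    have h0 := Complex.slitPlane_ne_zero (add_ofReal_mem_slitPlane hy ht)
    have h1 : HasDerivAt (fun t : ℝ => y + (t:ℂ)) 1 t := (Complex.ofRealCLM.hasDerivAt).const_add y
    have h2 := (hasDerivAt_exp_neg_div h0).comp t h1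
    simpa [Function.comp_def] using h2
  · exact (integrableOn_exp_neg_add_div_pow hy 1).neg.sub (integrableOn_exp_neg_add_div_pow hy 2)

/-- The integrand depends only on `y + t`, so its `y`-derivative is its `t`-derivative, and only the
boundary value at `t = 0` survives. -/
theorem E1_hasDerivAt {y : ℂ} (hy : y ∈ Complex.slitPlane) :
    HasDerivAt E1 (-(Complex.exp (-y) / y)) y := by
  obtain ⟨ε, hε, h⟩ := exists_le_norm_add_ofReal hy
  rw [← integral_deriv_exp_neg_add_div hy]
  have hs : Metric.ball y (min ε 1) ∈ 𝓝 y := Metric.ball_mem_nhds y (by positivity)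
  have hsub : ∀ y' ∈ Metric.ball y (min ε 1), y' ∈ Metric.ball y ε :=
    fun y' hy' => Metric.ball_subset_ball (min_le_left _ _) hy'
  refine (hasDerivAt_integral_of_dominated_loc_of_deriv_le
    (μ := MeasureTheory.volume.restrict (Set.Ioi (0:ℝ)))
    (F := fun (y : ℂ) (t : ℝ) => Complex.exp (-(y + t)) / (y + t))
    (F' := fun (y : ℂ) (t : ℝ) => (-(Complex.exp (-(y + t)) / (y + t) ^ 1)
      - Complex.exp (-(y + t)) / (y + t) ^ 2))
    (bound := fun t => Real.exp (-y.re + 1) / ε ^ 1 * Real.exp (-t)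
      + Real.exp (-y.re + 1) / ε ^ 2 * Real.exp (-t)) hs ?_ ?_ ?_ ?_ ?_ ?_).2
  · filter_upwards [hs] with y' hy'
    simpa using (integrableOn_exp_neg_add_div_pow (h y' (hsub y' hy')).1 1).aestronglyMeasurable
  · simpa [MeasureTheory.IntegrableOn] using integrableOn_exp_neg_add_div_pow hy 1
  · exact ((integrableOn_exp_neg_add_div_pow hy 1).neg.sub
      (integrableOn_exp_neg_add_div_pow hy 2)).aestronglyMeasurable
  · refine (MeasureTheory.ae_restrict_iff' measurableSet_Ioi).2 (Filter.Eventually.of_forall ?_)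
    intro t ht y' hy'
    have hre : -y'.re ≤ -y.re + 1 := by
      have h1 : ‖y' - y‖ < 1 := by
        rw [Metric.mem_ball, dist_eq_norm] at hy'
        exact lt_of_lt_of_le hy' (min_le_right _ _)
      have h2 := (Complex.abs_re_le_norm (y' - y)).trans_lt h1
      rw [abs_lt, Complex.sub_re] at h2
      linarith
    have hb (n : ℕ) : ‖Complex.exp (-(y' + t)) / (y' + t) ^ n‖ ≤
        Real.exp (-y.re + 1) / ε ^ n * Real.exp (-t) :=
      (norm_exp_neg_add_div_pow_le hε ((h y' (hsub y' hy')).2 t (le_of_lt ht)) n).trans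
        (by gcongr)
    refine (norm_sub_le _ _).trans ?_
    rw [norm_neg]
    exact add_le_add (hb 1) (hb 2)
  · exact ((integrableOn_exp_neg_Ioi 0).const_mul _).add ((integrableOn_exp_neg_Ioi 0).const_mul _)
  · refine (MeasureTheory.ae_restrict_iff' measurableSet_Ioi).2 (Filter.Eventually.of_forall ?_)
    intro t ht y' hy'
    have h0 := Complex.slitPlane_ne_zero
      (add_ofReal_mem_slitPlane (h y' (hsub y' hy')).1 (le_of_lt ht))
    have h2 := (hasDerivAt_exp_neg_div h0).comp y' ((hasDerivAt_id y').add_const (t:ℂ))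
    simpa [Function.comp_def] using h2

/-- After one integration by parts the remainder has `(y + t)^2` in the denominator, and `|y + t| ≥
|Im y|`. The sign of `Re y` plays no role, so the bound also covers the left half plane. -/
theorem norm_E1_sub_le {y : ℂ} (hy : y.im ≠ 0) :
    ‖E1 y - Complex.exp (-y) / y‖ ≤ Real.exp (-y.re) / y.im ^ 2 := by
  have hys : y ∈ Complex.slitPlane := by
    rw [Complex.mem_slitPlane_iff]; exact Or.inr hy
  have h := integral_deriv_exp_neg_add_div hys
  have i1 := integrableOn_exp_neg_add_div_pow hys 1
  have i2 := integrableOn_exp_neg_add_div_pow hys 2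
  have hsub := MeasureTheory.integral_sub i1.neg i2
  simp only [Pi.neg_apply] at hsub
  rw [hsub, MeasureTheory.integral_neg] at h
  have h3 : E1 y - Complex.exp (-y) / y =
      - ∫ t in Set.Ioi (0:ℝ), Complex.exp (-(y + t)) / (y + t) ^ 2 := by
    have h4 : E1 y = ∫ t in Set.Ioi (0:ℝ), Complex.exp (-(y + t)) / (y + t) ^ 1 := by
      simp [E1]
    rw [h4]
    linear_combination -h
  rw [h3, norm_neg]
  have hint : MeasureTheory.IntegrableOn
      (fun t : ℝ => Real.exp (-y.re) / |y.im| ^ 2 * Real.exp (-t)) (Set.Ioi 0) :=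
    (integrableOn_exp_neg_Ioi 0).const_mul _
  refine (MeasureTheory.norm_integral_le_of_norm_le hint ?_).trans ?_
  · refine Filter.Eventually.of_forall fun t => ?_
    refine norm_exp_neg_add_div_pow_le (abs_pos.2 hy) ?_ 2
    simpa using Complex.abs_im_le_norm (y + t)
  · rw [MeasureTheory.integral_const_mul, integral_exp_neg_Ioi]
    simp

theorem norm_E1_le {y : ℂ} (hy : 1 ≤ y.re) : ‖E1 y‖ ≤ Real.exp (-y.re) := by
  have hint : MeasureTheory.IntegrableOn
      (fun t : ℝ => Real.exp (-y.re) / 1 ^ 1 * Real.exp (-t)) (Set.Ioi 0) :=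
    (integrableOn_exp_neg_Ioi 0).const_mul _
  refine (MeasureTheory.norm_integral_le_of_norm_le hint ?_).trans ?_
  · refine (MeasureTheory.ae_restrict_iff' measurableSet_Ioi).2 (Filter.Eventually.of_forall ?_)
    intro t ht
    have h := norm_exp_neg_add_div_pow_le (y := y) (t := t) one_pos ?_ 1
    · simpa using h
    · refine le_trans ?_ (Complex.re_le_norm _)
      have : (0:ℝ) < t := ht
      simp; linarith
  · rw [MeasureTheory.integral_const_mul, integral_exp_neg_Ioi]
    simp

/-- Rotation of the ray of integration. -/
theorem integral_exp_neg_mul_div_eq_E1 {z : ℂ} (hz : 0 < z.re) {b : ℝ} (hb : 0 < b) :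
    MeasureTheory.IntegrableOn (fun t : ℝ => Complex.exp (-(z * t)) / t) (Set.Ioi b) ∧
    ∫ t in Set.Ioi b, Complex.exp (-(z * t)) / t = E1 (z * b) := by
  have hint : MeasureTheory.IntegrableOn (fun t : ℝ => Complex.exp (-(z * t)) / t) (Set.Ioi b) := by
    have hi : MeasureTheory.IntegrableOn
      (fun t : ℝ => Real.exp (-z.re * t) * b⁻¹) (Set.Ioi b) :=
      (integrableOn_exp_mul_Ioi (by linarith) b).mul_const _
    refine MeasureTheory.Integrable.mono' hi ?_ ?_
    · refine ContinuousOn.aestronglyMeasurable ?_ measurableSet_Ioi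
      refine ContinuousOn.div (by fun_prop) (by fun_prop) fun t ht => ?_
      exact_mod_cast (hb.trans ht).ne'
    · refine (MeasureTheory.ae_restrict_iff' measurableSet_Ioi).2 (Filter.Eventually.of_forall ?_)
      intro t ht
      have ht : b < t := ht
      rw [norm_div, Complex.norm_exp, div_eq_mul_inv]
      have : (-(z * t)).re = -z.re * t := by simp
      rw [this, Complex.norm_real, Real.norm_of_nonneg (hb.trans ht).le]
      gcongr
  refine ⟨hint, ?_⟩
  -- No contour is moved: `t ↦ E1(zt)` is a primitive of `-e^{-zt}/t` that vanishes at infinity.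
  have key := MeasureTheory.integral_Ioi_of_hasDerivAt_of_tendsto'
    (f := fun t : ℝ => E1 (z * t)) (a := b) (m := 0)
    (f' := fun t : ℝ => -(Complex.exp (-(z * t)) / t)) ?_ hint.neg ?_
  · rw [MeasureTheory.integral_neg] at key
    linear_combination -key
  · intro t ht
    have ht : 0 < t := lt_of_lt_of_le hb ht
    have hm : z * t ∈ Complex.slitPlane := by
      rw [Complex.mem_slitPlane_iff]; left; simp; positivity
    have h1 : HasDerivAt (fun t : ℝ => z * (t:ℂ)) z t := by
      simpa using (Complex.ofRealCLM.hasDerivAt (x := t)).const_mul z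
    have h2 := (E1_hasDerivAt hm).comp t h1
    convert! h2 using 1
    have hz0 : z ≠ 0 := by rintro rfl; simp at hz
    have ht0 : (t:ℂ) ≠ 0 := by exact_mod_cast ht.ne'
    field_simp
  · have h1 : Filter.Tendsto (fun t : ℝ => Real.exp (-(z.re * t))) Filter.atTop (𝓝 0) := by
      refine Real.tendsto_exp_neg_atTop_nhds_zero.comp ?_
      exact Filter.tendsto_id.const_mul_atTop hz
    refine squeeze_zero_norm' ?_ h1
    filter_upwards [Filter.eventually_ge_atTop (1 / z.re)] with t ht
    have : 1 ≤ z.re * t := by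
      rw [div_le_iff₀ hz] at ht; linarith
    simpa using norm_E1_le (y := z * t) (by simpa using this)

/-! ### Two integrations by parts -/

theorem integral_mul_exp_neg_by_parts {K : ℝ → ℂ} (hK : ContDiff ℝ 1 K) {z : ℂ} (hz : z ≠ 0)
    (b : ℝ) :
    ∫ t in (0:ℝ)..b, K t * Complex.exp (-(z * t)) =
      (K 0 - K b * Complex.exp (-(z * b))) / z +
        (∫ t in (0:ℝ)..b, deriv K t * Complex.exp (-(z * t))) / z := by
  have hv (t : ℝ) : HasDerivAt (fun t : ℝ => -(Complex.exp (-(z * t)) / z))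
      (Complex.exp (-(z * t))) t := by
    have h1 : HasDerivAt (fun t : ℝ => -(z * (t:ℂ))) (-z) t := by
      simpa [Pi.neg_def] using ((Complex.ofRealCLM.hasDerivAt (x := t)).const_mul z).neg
    convert! (h1.cexp.div_const z).neg using 1
    field_simp
  have h := intervalIntegral.integral_mul_deriv_eq_deriv_mul (a := 0) (b := b)
    (u := K) (u' := deriv K) (v := fun t : ℝ => -(Complex.exp (-(z * t)) / z))
    (v' := fun t : ℝ => Complex.exp (-(z * t)))
    (fun t _ => (hK.differentiable one_ne_zero t).hasDerivAt) (fun t _ => hv t)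
    ((hK.continuous_deriv le_rfl).intervalIntegrable _ _)
    (Continuous.intervalIntegrable (by fun_prop) _ _)
  rw [h]
  have : ∫ t in (0:ℝ)..b, deriv K t * -(Complex.exp (-(z * t)) / z) =
      -((∫ t in (0:ℝ)..b, deriv K t * Complex.exp (-(z * t))) / z) := by
    rw [← intervalIntegral.integral_div, ← intervalIntegral.integral_neg]
    congr 1; ext t; ring
  rw [this]
  simp
  ring

theorem norm_integral_mul_exp_neg_le {K : ℝ → ℂ} (hK : Continuous K) {b : ℝ} (hb : 0 ≤ b) (M : ℝ) :
    ∃ C, ∀ z : ℂ, |z.re| ≤ M → ‖∫ t in (0:ℝ)..b, K t * Complex.exp (-(z * t))‖ ≤ C := by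
  obtain ⟨B, hB⟩ := (isCompact_Icc (a := (0:ℝ)) (b := b)).exists_bound_of_continuousOn
    hK.continuousOn
  refine ⟨B * Real.exp (M * b) * |b - 0|, fun z hz => ?_⟩
  refine intervalIntegral.norm_integral_le_of_norm_le_const fun t ht => ?_
  rw [Set.uIoc_of_le hb] at ht
  have hB0 : 0 ≤ B := (norm_nonneg _).trans (hB t ⟨ht.1.le, ht.2⟩)
  rw [norm_mul, Complex.norm_exp]
  refine mul_le_mul (hB t ⟨ht.1.le, ht.2⟩) (Real.exp_le_exp.2 ?_) (Real.exp_nonneg _) hB0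
  have h1 : (-(z * t)).re = -z.re * t := by simp
  rw [h1]
  have h2 := abs_le.1 hz
  calc -z.re * t ≤ M * t := by gcongr; exacts [ht.1.le, by linarith]
    _ ≤ M * b := by gcongr; exacts [by linarith, ht.2]

/-- The first integration by parts leaves only the endpoint term at `b`, because `K 0 = 0`; the
second puts everything else at order `1/z^2`. The term at `b` is kept explicit so that it can cancel
against the leading term of `E1`. -/
theorem norm_integral_mul_exp_neg_add_le {K : ℝ → ℂ} (hK : ContDiff ℝ 2 K) (hK0 : K 0 = 0)
    {b : ℝ} (hb : 0 ≤ b) (M : ℝ) :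
    ∃ C, 0 ≤ C ∧ ∀ z : ℂ, z ≠ 0 → |z.re| ≤ M →
      ‖(∫ t in (0:ℝ)..b, K t * Complex.exp (-(z * t))) + K b * Complex.exp (-(z * b)) / z‖
        ≤ C / ‖z‖ ^ 2 := by
  have hK1 : ContDiff ℝ 1 (deriv K) := by
    have : ContDiff ℝ (1 + 1) K := by norm_num; exact hK
    exact (contDiff_succ_iff_deriv.1 this).2.2
  obtain ⟨C, hC⟩ := norm_integral_mul_exp_neg_le (hK1.continuous_deriv le_rfl) hb M
  refine ⟨‖deriv K 0‖ + ‖deriv K b‖ * Real.exp (M * b) + |C|, by positivity, fun z hz hM => ?_⟩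
  rw [integral_mul_exp_neg_by_parts (hK.of_le (by norm_num)) hz,
    integral_mul_exp_neg_by_parts hK1 hz, hK0]
  have : (0 - K b * Complex.exp (-(z * b))) / z + ((deriv K 0 - deriv K b *
      Complex.exp (-(z * b))) / z + (∫ t in (0:ℝ)..b, deriv (deriv K) t *
      Complex.exp (-(z * t))) / z) / z + K b * Complex.exp (-(z * b)) / z =
      (deriv K 0 - deriv K b * Complex.exp (-(z * b)) + ∫ t in (0:ℝ)..b, deriv (deriv K) t *
      Complex.exp (-(z * t))) / z ^ 2 := by
    field_simp
    ring
  rw [this, norm_div, norm_pow]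
  gcongr
  refine (norm_add_le _ _).trans (add_le_add ((norm_sub_le _ _).trans (add_le_add le_rfl ?_))
    ((hC z hM).trans (le_abs_self C)))
  rw [norm_mul, Complex.norm_exp]
  have h1 : (-(z * b)).re = -z.re * b := by simp
  rw [h1]
  have h2 := abs_le.1 hM
  gcongr
  linarith

theorem differentiable_integral_mul_exp_neg {K : ℝ → ℂ} (hK : Continuous K) {b : ℝ} (hb : 0 ≤ b) :
    Differentiable ℂ fun z : ℂ => ∫ t in (0:ℝ)..b, K t * Complex.exp (-(z * t)) := by
  intro z
  obtain ⟨B, hB⟩ := (isCompact_Icc (a := (0:ℝ)) (b := b)).exists_bound_of_continuousOn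
    hK.continuousOn
  refine (intervalIntegral.hasDerivAt_integral_of_dominated_loc_of_deriv_le
    (μ := MeasureTheory.volume)
    (F := fun (z : ℂ) (t : ℝ) => K t * Complex.exp (-(z * t)))
    (F' := fun (z : ℂ) (t : ℝ) => K t * (Complex.exp (-(z * t)) * -t))
    (bound := fun _ => B * (Real.exp ((‖z‖ + 1) * b) * b)) (Metric.ball_mem_nhds z one_pos)
    ?_ ?_ ?_ ?_ ?_ ?_).2.differentiableAt
  · exact Filter.Eventually.of_forall fun w =>
      Continuous.aestronglyMeasurable (by fun_prop)
  · exact Continuous.intervalIntegrable (by fun_prop) _ _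
  · exact Continuous.aestronglyMeasurable (by fun_prop)
  · refine Filter.Eventually.of_forall fun t ht w hw => ?_
    rw [Set.uIoc_of_le hb] at ht
    have hB0 : 0 ≤ B := (norm_nonneg _).trans (hB t ⟨ht.1.le, ht.2⟩)
    have hw' : -w.re ≤ ‖z‖ + 1 := by
      rw [Metric.mem_ball, dist_eq_norm] at hw
      have h1 : ‖w‖ ≤ ‖z‖ + 1 := by
        calc ‖w‖ = ‖z + (w - z)‖ := by congr 1; ring
          _ ≤ ‖z‖ + ‖w - z‖ := norm_add_le _ _
          _ ≤ ‖z‖ + 1 := by linarith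
      linarith [(abs_le.1 (Complex.abs_re_le_norm w)).1]
    rw [norm_mul, norm_mul, Complex.norm_exp, norm_neg, Complex.norm_real,
      Real.norm_of_nonneg ht.1.le]
    have h1 : (-(w * t)).re = -w.re * t := by simp
    rw [h1]
    have h2 : -w.re * t ≤ (‖z‖ + 1) * b :=
      (mul_le_mul_of_nonneg_right hw' ht.1.le).trans
        (mul_le_mul_of_nonneg_left ht.2 (by positivity))
    refine mul_le_mul (hB t ⟨ht.1.le, ht.2⟩) ?_ (mul_nonneg (Real.exp_nonneg _) ht.1.le) hB0
    exact mul_le_mul (Real.exp_le_exp.2 h2) ht.2 ht.1.le (Real.exp_nonneg _)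
  · exact intervalIntegrable_const
  · refine Filter.Eventually.of_forall fun t _ w _ => ?_
    have h1 : HasDerivAt (fun w : ℂ => -(w * t)) (-t) w := by
      simpa [Pi.neg_def] using ((hasDerivAt_id w).mul_const (t:ℂ)).neg
    exact h1.cexp.const_mul _

/-! ### The smoothed kernel attached to the weight -/

section Weight

/-- `∫_0^{e^t} u(x) dx`, that is `1 - v(e^t)` for a normalised weight. -/
noncomputable def expPrimitive (u : ℝ → ℝ) (t : ℝ) : ℝ := ∫ x in (0:ℝ)..Real.exp t, u x

/-- The kernel `(1 - v(e^t)) / t`, of which `U` is the Laplace transform. -/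
noncomputable def laplaceKernel (u : ℝ → ℝ) (t : ℝ) : ℂ := ((expPrimitive u t / t : ℝ) : ℂ)

variable {u : ℝ → ℝ} {δ : ℝ}

theorem expPrimitive_hasDerivAt (hu : Continuous u) (t : ℝ) :
    HasDerivAt (expPrimitive u) (u (Real.exp t) * Real.exp t) t :=
  (intervalIntegral.integral_hasDerivAt_right (hu.intervalIntegrable _ _)
    (hu.stronglyMeasurableAtFilter _ _) hu.continuousAt).comp t (Real.hasDerivAt_exp t)

theorem expPrimitive_contDiff (hu : ContDiff ℝ ∞ u) : ContDiff ℝ ∞ (expPrimitive u) := by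
  rw [contDiff_infty_iff_deriv]
  refine ⟨fun t => (expPrimitive_hasDerivAt hu.continuous t).differentiableAt, ?_⟩
  have : deriv (expPrimitive u) = fun t => u (Real.exp t) * Real.exp t :=
    funext fun t => (expPrimitive_hasDerivAt hu.continuous t).deriv
  rw [this]
  exact (hu.comp Real.contDiff_exp).mul Real.contDiff_exp

theorem expPrimitive_eq_zero (hu : Continuous u)
    (hs : Function.support u ⊆ Set.Icc (Real.exp 1) (Real.exp (1 + δ))) {t : ℝ} (ht : t ≤ 1) :
    expPrimitive u t = 0 := by
  have h0 : ∀ x < Real.exp 1, u x = 0 := fun x hx => by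
    by_contra h
    exact absurd (hs h).1 (not_le.2 hx)
  have h1 : ∀ x ≤ Real.exp 1, u x = 0 := by
    have hc : IsClosed {x | u x = 0} := isClosed_eq hu continuous_const
    intro x hx
    have : closure (Set.Iio (Real.exp 1)) ⊆ {x | u x = 0} := hc.closure_subset_iff.2 h0
    rw [closure_Iio] at this
    exact this hx
  rw [expPrimitive, intervalIntegral.integral_congr (g := fun _ => 0)]
  · simp
  · intro x hx
    rw [Set.uIcc_of_le (Real.exp_nonneg _)] at hx
    exact h1 x (hx.2.trans (Real.exp_le_exp.2 ht))

theorem expPrimitive_eq_one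
    (hs : Function.support u ⊆ Set.Icc (Real.exp 1) (Real.exp (1 + δ)))
    (hn : vWeight u 0 = 1) {t : ℝ} (ht : 1 + δ ≤ t) :
    expPrimitive u t = 1 := by
  rw [expPrimitive, intervalIntegral.integral_of_le (Real.exp_nonneg _), ← hn, vWeight]
  symm
  refine MeasureTheory.setIntegral_eq_of_subset_of_forall_sdiff_eq_zero measurableSet_Ioi
    Set.Ioc_subset_Ioi_self fun x hx => ?_
  by_contra h
  exact hx.2 ⟨hx.1, (hs h).2.trans (Real.exp_le_exp.2 ht)⟩

theorem laplaceKernel_eq_zero (hu : Continuous u)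
    (hs : Function.support u ⊆ Set.Icc (Real.exp 1) (Real.exp (1 + δ))) {t : ℝ} (ht : t ≤ 1) :
    laplaceKernel u t = 0 := by
  simp [laplaceKernel, expPrimitive_eq_zero hu hs ht]

theorem laplaceKernel_eq_inv
    (hs : Function.support u ⊆ Set.Icc (Real.exp 1) (Real.exp (1 + δ)))
    (hn : vWeight u 0 = 1) {t : ℝ} (ht : 1 + δ ≤ t) :
    laplaceKernel u t = (t : ℂ)⁻¹ := by
  simp [laplaceKernel, expPrimitive_eq_one hs hn ht]

/-- The division by `t` does no harm: the numerator vanishes identically for `t ≤ 1`. -/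
theorem laplaceKernel_contDiff (hu : ContDiff ℝ ∞ u)
    (hs : Function.support u ⊆ Set.Icc (Real.exp 1) (Real.exp (1 + δ))) :
    ContDiff ℝ ∞ (laplaceKernel u) := by
  rw [contDiff_iff_contDiffAt]
  intro t
  rcases lt_or_ge t 1 with h | h
  · refine (contDiffAt_const (c := (0:ℂ))).congr_of_eventuallyEq ?_
    filter_upwards [Iio_mem_nhds h] with x hx
    exact laplaceKernel_eq_zero hu.continuous hs (le_of_lt hx)
  · have h1 : ContDiffAt ℝ ∞ (fun t => expPrimitive u t / t) t :=
      (expPrimitive_contDiff hu).contDiffAt.div contDiffAt_id (by simp; linarith)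
    exact (Complex.ofRealCLM.contDiff (n := ∞)).contDiffAt.comp t h1

theorem mul_ofReal_mem_slitPlane {z : ℂ} (hz : z ∈ Complex.slitPlane) {t : ℝ} (ht : 0 < t) :
    z * t ∈ Complex.slitPlane := by
  rw [Complex.mem_slitPlane_iff] at hz ⊢
  rcases hz with h | h
  · left; simp; positivity
  · right; simpa using ⟨h, ht.ne'⟩

theorem E1_mul_hasDerivAt {z : ℂ} (hz : z ∈ Complex.slitPlane) {t : ℝ} (ht : 0 < t) :
    HasDerivAt (fun t : ℝ => E1 (z * t)) (-(Complex.exp (-(z * t)) / t)) t := by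
  have h1 : HasDerivAt (fun t : ℝ => z * (t:ℂ)) z t := by
    simpa using (Complex.ofRealCLM.hasDerivAt (x := t)).const_mul z
  convert! (E1_hasDerivAt (mul_ofReal_mem_slitPlane hz ht)).comp t h1 using 1
  have hz0 : z ≠ 0 := Complex.slitPlane_ne_zero hz
  have ht0 : (t:ℂ) ≠ 0 := by exact_mod_cast ht.ne'
  field_simp

theorem continuousOn_weight_mul_E1 (hu : Continuous u) {z : ℂ} (hz : z ∈ Complex.slitPlane) :
    ContinuousOn (fun x : ℝ => (u x : ℂ) * E1 (z * (Real.log x : ℂ))) (Set.Ioi 1) := by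
  refine ContinuousOn.mul (by fun_prop) fun x hx => ContinuousAt.continuousWithinAt ?_
  have hx : 1 < x := hx
  exact ContinuousAt.comp (f := Real.log) (g := fun t : ℝ => E1 (z * t))
    (E1_mul_hasDerivAt hz (Real.log_pos hx)).continuousAt
    (Real.continuousAt_log (by linarith))

theorem integrableOn_weight_mul_E1 (hu : Continuous u)
    (hs : Function.support u ⊆ Set.Icc (Real.exp 1) (Real.exp (1 + δ)))
    {z : ℂ} (hz : z ∈ Complex.slitPlane) :
    MeasureTheory.IntegrableOn
      (fun x : ℝ => (u x : ℂ) * E1 (z * (Real.log x : ℂ))) (Set.Ioi 0) := by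
  have h1 : MeasureTheory.IntegrableOn (fun x : ℝ => (u x : ℂ) * E1 (z * (Real.log x : ℂ)))
      (Set.Icc (Real.exp 1) (Real.exp (1 + δ))) := by
    refine ContinuousOn.integrableOn_Icc ((continuousOn_weight_mul_E1 hu hz).mono fun x hx => ?_)
    exact lt_of_lt_of_le (Real.one_lt_exp_iff.2 one_pos) hx.1
  refine h1.of_forall_sdiff_eq_zero measurableSet_Ioi fun x hx => ?_
  have : u x = 0 := by
    by_contra h
    exact hx.2 (hs h)
  simp [this]

/-- Substitute `x = e^t` and integrate by parts against the primitive of the weight, which is 0 at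
`t = 1` and 1 at `t = 2 ≥ 1 + δ`. Cutting the Laplace integral at 2 and keeping its tail as `E1(2z)`
makes the formula valid on the whole slit plane. -/
theorem UWeight_eq (hu : ContDiff ℝ ∞ u) (hδ : δ ≤ 1)
    (hs : Function.support u ⊆ Set.Icc (Real.exp 1) (Real.exp (1 + δ)))
    (hn : vWeight u 0 = 1) {z : ℂ} (hz : z ∈ Complex.slitPlane) :
    UWeight u z = E1 (z * (2 : ℝ)) +
      ∫ t in (0:ℝ)..2, laplaceKernel u t * Complex.exp (-(z * t)) := by
  have hu0 := hu.continuous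
  have h12 : Real.exp 1 ≤ Real.exp 2 := Real.exp_le_exp.2 (by norm_num)
  have e1 : UWeight u z = ∫ x in (Real.exp 1)..(Real.exp 2),
      (u x : ℂ) * E1 (z * (Real.log x : ℂ)) := by
    rw [intervalIntegral.integral_of_le h12, ← MeasureTheory.integral_Icc_eq_integral_Ioc, UWeight]
    refine MeasureTheory.setIntegral_eq_of_subset_of_forall_sdiff_eq_zero measurableSet_Ioi
      (fun x hx => lt_of_lt_of_le (Real.exp_pos _) hx.1) fun x hx => ?_
    have : u x = 0 := by
      by_contra h
      exact hx.2 ⟨(hs h).1, (hs h).2.trans (Real.exp_le_exp.2 (by linarith))⟩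
    simp [this]
  have e2 : ∫ x in (Real.exp 1)..(Real.exp 2), (u x : ℂ) * E1 (z * (Real.log x : ℂ)) =
      ∫ t in (1:ℝ)..2, E1 (z * t) * ((u (Real.exp t) * Real.exp t : ℝ) : ℂ) := by
    have h := intervalIntegral.integral_deriv_smul_comp' (a := 1) (b := 2) (f := Real.exp)
      (f' := Real.exp) (g := fun x : ℝ => (u x : ℂ) * E1 (z * (Real.log x : ℂ)))
      (fun t _ => Real.hasDerivAt_exp t) Real.continuous_exp.continuousOn
      ((continuousOn_weight_mul_E1 hu0 hz).mono ?_)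
    · rw [← h]
      congr 1; ext t
      simp only [Function.comp_apply, Real.log_exp, Complex.real_smul]
      push_cast
      ring
    · rintro _ ⟨t, ht, rfl⟩
      rw [Set.uIcc_of_le (by norm_num)] at ht
      exact Real.one_lt_exp_iff.2 (by linarith [ht.1])
  have hpos : ∀ t ∈ Set.uIcc (1:ℝ) 2, 0 < t := fun t ht => by
    rw [Set.uIcc_of_le (by norm_num)] at ht
    linarith [ht.1]
  have e3 := intervalIntegral.integral_mul_deriv_eq_deriv_mul (a := 1) (b := 2)
    (u := fun t : ℝ => E1 (z * t)) (u' := fun t : ℝ => -(Complex.exp (-(z * t)) / t))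
    (v := fun t : ℝ => (expPrimitive u t : ℂ))
    (v' := fun t : ℝ => ((u (Real.exp t) * Real.exp t : ℝ) : ℂ))
    (fun t ht => E1_mul_hasDerivAt hz (hpos t ht))
    (fun t _ => (expPrimitive_hasDerivAt hu0 t).ofReal_comp)
    (ContinuousOn.intervalIntegrable (ContinuousOn.neg (ContinuousOn.div (by fun_prop) (by fun_prop)
      fun t ht => by exact_mod_cast (hpos t ht).ne')))
    (Continuous.intervalIntegrable (by fun_prop) _ _)
  rw [e1, e2, e3, expPrimitive_eq_one hs hn (by linarith), expPrimitive_eq_zero hu0 hs le_rfl]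
  have e4 : ∫ t in (1:ℝ)..2, -(Complex.exp (-(z * t)) / t) * (expPrimitive u t : ℂ) =
      -∫ t in (1:ℝ)..2, laplaceKernel u t * Complex.exp (-(z * t)) := by
    rw [← intervalIntegral.integral_neg]
    congr 1; ext t
    simp [laplaceKernel]
    ring
  have hc : Continuous fun t : ℝ => laplaceKernel u t * Complex.exp (-(z * t)) :=
    (laplaceKernel_contDiff hu hs).continuous.mul (by fun_prop)
  have e5 : ∫ t in (0:ℝ)..1, laplaceKernel u t * Complex.exp (-(z * t)) = 0 := by
    rw [intervalIntegral.integral_congr (g := fun _ => 0)]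
    · simp
    · intro t ht
      rw [Set.uIcc_of_le (by norm_num)] at ht
      simp [laplaceKernel_eq_zero hu0 hs ht.2]
  rw [e4, ← intervalIntegral.integral_add_adjacent_intervals (hc.intervalIntegrable 0 1)
    (hc.intervalIntegrable 1 2), e5]
  simp

theorem UWeight_differentiableOn (hu : ContDiff ℝ ∞ u) (hδ : δ ≤ 1)
    (hs : Function.support u ⊆ Set.Icc (Real.exp 1) (Real.exp (1 + δ)))
    (hn : vWeight u 0 = 1) : DifferentiableOn ℂ (UWeight u) Complex.slitPlane := by
  have h : DifferentiableOn ℂ (fun z => E1 (z * (2 : ℝ)) +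
      ∫ t in (0:ℝ)..2, laplaceKernel u t * Complex.exp (-(z * t))) Complex.slitPlane := by
    refine DifferentiableOn.add (fun z hz => ?_) (differentiable_integral_mul_exp_neg
      (laplaceKernel_contDiff hu hs).continuous zero_le_two).differentiableOn
    exact ((E1_hasDerivAt (mul_ofReal_mem_slitPlane hz two_pos)).comp z
      ((hasDerivAt_id z).mul_const _)).differentiableAt.differentiableWithinAt
  exact h.congr fun z hz => UWeight_eq hu hδ hs hn hz

/-- Both summands of `UWeight_eq` are only of order `1/|z|`, but their leading terms are
`e^{-2z}/(2z)` and `-K(2)e^{-2z}/z` with `K(2) = 1/2`, and they cancel. The resulting inverse square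
decay makes the sum over a vertical lattice converge absolutely. -/
theorem norm_UWeight_le (hu : ContDiff ℝ ∞ u) (hδ : δ ≤ 1)
    (hs : Function.support u ⊆ Set.Icc (Real.exp 1) (Real.exp (1 + δ)))
    (hn : vWeight u 0 = 1) (M : ℝ) :
    ∃ C, 0 ≤ C ∧ ∀ z : ℂ, z.im ≠ 0 → |z.re| ≤ M → ‖UWeight u z‖ ≤ C / z.im ^ 2 := by
  obtain ⟨C, hC0, hC⟩ := norm_integral_mul_exp_neg_add_le
    ((laplaceKernel_contDiff hu hs).of_le (WithTop.coe_le_coe.2 le_top))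
    (laplaceKernel_eq_zero hu.continuous hs zero_le_one) zero_le_two M
  refine ⟨Real.exp (M * 2) + C, by positivity, fun z hz hM => ?_⟩
  have hz0 : z ≠ 0 := by rintro rfl; simp at hz
  have h1 := norm_E1_sub_le (y := z * (2:ℝ)) (by simpa using hz)
  have h2 := hC z hz0 hM
  rw [laplaceKernel_eq_inv hs hn (by linarith)] at h2
  rw [UWeight_eq hu hδ hs hn (Complex.mem_slitPlane_iff.2 (Or.inr hz))]
  set I := ∫ t in (0:ℝ)..2, laplaceKernel u t * Complex.exp (-(z * t))
  have e : E1 (z * (2:ℝ)) + I = (E1 (z * (2:ℝ)) - Complex.exp (-(z * (2:ℝ))) / (z * (2:ℝ))) +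
      (I + ((2:ℝ):ℂ)⁻¹ * Complex.exp (-(z * (2:ℝ))) / z) := by
    field_simp
    ring
  rw [e, add_div]
  refine (norm_add_le _ _).trans (add_le_add (h1.trans ?_) (h2.trans ?_))
  · have h3 := abs_le.1 hM
    have h4 : -(z * (2:ℝ)).re ≤ M * 2 := by simp; linarith
    have h5 : z.im ^ 2 ≤ (z * (2:ℝ)).im ^ 2 := by simp; nlinarith [sq_nonneg z.im]
    have : 0 < z.im ^ 2 := by positivity
    gcongr
  · have : 0 < z.im ^ 2 := by positivity
    have h6 : z.im ^ 2 ≤ ‖z‖ ^ 2 := by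
      rw [← sq_abs z.im]
      exact pow_le_pow_left₀ (abs_nonneg _) (Complex.abs_im_le_norm z) 2
    gcongr

/-- On the right half plane, `U` is the Laplace transform of its kernel. -/
theorem integral_laplaceKernel_mul_exp (hu : ContDiff ℝ ∞ u) (hδ : δ ≤ 1)
    (hs : Function.support u ⊆ Set.Icc (Real.exp 1) (Real.exp (1 + δ)))
    (hn : vWeight u 0 = 1) {z : ℂ} (hz : 0 < z.re) :
    ∫ t : ℝ, laplaceKernel u t * Complex.exp (-(z * t)) = UWeight u z := by
  have hc : Continuous fun t : ℝ => laplaceKernel u t * Complex.exp (-(z * t)) :=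
    (laplaceKernel_contDiff hu hs).continuous.mul (by fun_prop)
  obtain ⟨i1, i2⟩ := integral_exp_neg_mul_div_eq_E1 hz two_pos
  have e : ∫ t : ℝ, laplaceKernel u t * Complex.exp (-(z * t)) =
      ∫ t in Set.Ioi (0:ℝ), laplaceKernel u t * Complex.exp (-(z * t)) := by
    rw [MeasureTheory.setIntegral_eq_integral_of_forall_compl_eq_zero]
    intro t ht
    have ht : t ≤ 0 := by simpa using ht
    rw [laplaceKernel_eq_zero hu.continuous hs (by linarith), zero_mul]
  have e2 : Set.EqOn (fun t : ℝ => laplaceKernel u t * Complex.exp (-(z * t)))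
      (fun t : ℝ => Complex.exp (-(z * t)) / t) (Set.Ioi 2) := by
    intro t ht
    have ht : 2 < t := ht
    simp only
    rw [laplaceKernel_eq_inv hs hn (by linarith)]
    ring
  have i3 : MeasureTheory.IntegrableOn
      (fun t : ℝ => laplaceKernel u t * Complex.exp (-(z * t))) (Set.Ioi 2) :=
    i1.congr_fun e2.symm measurableSet_Ioi
  rw [e, UWeight_eq hu hδ hs hn (Complex.mem_slitPlane_iff.2 (Or.inl hz)), ← i2,
    ← Set.Ioc_union_Ioi_eq_Ioi (zero_le_two (α := ℝ)),
    MeasureTheory.setIntegral_union (Set.Ioc_disjoint_Ioi le_rfl) measurableSet_Ioi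
      (hc.integrableOn_Ioc) i3, MeasureTheory.setIntegral_congr_fun measurableSet_Ioi e2,
    intervalIntegral.integral_of_le zero_le_two, add_comm]

end Weight

/-! ### The plane cut along a vertical lattice of rays. -/

/-- The number `1 - e^{-z}` lies on the cut exactly when `e^{-z}` is real and at least 1, that is,
when `z` is a nonpositive real modulo `2πi`. -/
theorem one_sub_exp_neg_mem_slitPlane_iff {z : ℂ} :
    1 - Complex.exp (-z) ∈ Complex.slitPlane ↔
      ∀ k : ℤ, z + k * (2 * Real.pi * Complex.I) ∈ Complex.slitPlane := by
  constructor
  · intro h k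
    by_contra hk
    rw [Complex.mem_slitPlane_iff, not_or, not_lt, not_not] at hk
    set w := z + k * (2 * Real.pi * Complex.I) with hw
    have h1 : Complex.exp (-z) = Complex.exp (-w) := by
      rw [Complex.exp_eq_exp_iff_exists_int]
      exact ⟨k, by rw [hw]; ring⟩
    have h2 : -w = ((-w.re : ℝ) : ℂ) := by
      apply Complex.ext <;> simp [hk.2]
    rw [h1, h2, ← Complex.ofReal_exp, Complex.mem_slitPlane_iff] at h
    simp only [Complex.sub_re, Complex.one_re, Complex.ofReal_re, Complex.sub_im, Complex.one_im,
      Complex.ofReal_im, sub_self, ne_eq, not_true_eq_false, or_false] at h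
    have := Real.one_le_exp (x := -w.re) (by linarith [hk.1])
    linarith
  · intro h
    by_contra hk
    rw [Complex.mem_slitPlane_iff, not_or, not_lt, not_not] at hk
    simp only [Complex.sub_re, Complex.one_re, Complex.sub_im, Complex.one_im] at hk
    set r := (Complex.exp (-z)).re with hr
    have h1 : Complex.exp (-z) = Complex.exp (Real.log r : ℝ) := by
      rw [← Complex.ofReal_exp, Real.exp_log (by linarith [hk.1])]
      apply Complex.ext
      · simp [hr]
      · simp; linarith [hk.2]
    obtain ⟨n, hn⟩ := Complex.exp_eq_exp_iff_exists_int.1 h1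
    have h2 : z + n * (2 * Real.pi * Complex.I) = ((-Real.log r : ℝ) : ℂ) := by
      push_cast
      linear_combination -hn
    have h3 := h n
    rw [h2, Complex.mem_slitPlane_iff] at h3
    simp only [Complex.ofReal_re, Complex.ofReal_im, ne_eq, not_true_eq_false, or_false] at h3
    have := Real.log_nonneg (x := r) (by linarith [hk.1])
    linarith

/-- The complement of the translates by `2πiℤ` of the ray `(-∞, 0]`. -/
def periodicSlitPlane : Set ℂ := {z | 1 - Complex.exp (-z) ∈ Complex.slitPlane}

theorem isOpen_periodicSlitPlane : IsOpen periodicSlitPlane :=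
  Complex.isOpen_slitPlane.preimage (by fun_prop)

theorem mem_periodicSlitPlane_of_re_pos {z : ℂ} (hz : 0 < z.re) : z ∈ periodicSlitPlane :=
  one_sub_exp_neg_mem_slitPlane_iff.2 fun k => Complex.mem_slitPlane_iff.2 (Or.inl (by simpa))

/-- The horizontal ray from any point to the right avoids all cuts and ends up in the right half
plane, which is contained in the set. -/
theorem isPreconnected_periodicSlitPlane : IsPreconnected periodicSlitPlane := by
  refine isPreconnected_of_forall (1 : ℂ) fun z hz => ?_
  have hc : IsPreconnected ((fun t : ℝ => z + t) '' Set.Ici 0) :=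
    (convex_Ici (0:ℝ)).isPreconnected.image _ (Continuous.continuousOn (by fun_prop))
  have hr : IsPreconnected {w : ℂ | 0 < w.re} := (convex_halfSpace_re_gt 0).isPreconnected
  refine ⟨_ ∪ _, ?_, ?_, ?_, IsPreconnected.union (z + (|z.re| + 1 : ℝ)) ?_ ?_ hc hr⟩
  · rintro w (⟨t, ht, rfl⟩ | hw)
    · refine one_sub_exp_neg_mem_slitPlane_iff.2 fun k => ?_
      rw [add_right_comm]
      exact add_ofReal_mem_slitPlane (one_sub_exp_neg_mem_slitPlane_iff.1 hz k) ht
    · exact mem_periodicSlitPlane_of_re_pos hw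
  · right; simp
  · left; exact ⟨0, by simp, by simp⟩
  · exact ⟨|z.re| + 1, by simp; positivity, rfl⟩
  · simp only [Set.mem_ofPred_eq, Complex.add_re, Complex.ofReal_re]
    linarith [neg_abs_le z.re]

/-! ### Summation of `U` over a vertical lattice. -/

section Sum

variable {u : ℝ → ℝ} {δ : ℝ}

theorem norm_UWeight_translate_le (hu : ContDiff ℝ ∞ u) (hδ : δ ≤ 1)
    (hs : Function.support u ⊆ Set.Icc (Real.exp 1) (Real.exp (1 + δ)))
    (hn : vWeight u 0 = 1) {X : ℕ} (hX : 1 ≤ X) (z₀ : ℂ) :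
    ∃ (C : ℝ) (N : ℕ), 0 ≤ C ∧ ∀ z : ℂ, ‖z - z₀‖ ≤ 1 → ∀ k : ℤ, (N : ℤ) < |k| →
      ‖UWeight u ((z + k * (2 * Real.pi * Complex.I)) * X)‖ ≤ C * (1 / (k : ℝ) ^ 2) := by
  obtain ⟨C, hC0, hC⟩ := norm_UWeight_le hu hδ hs hn ((|z₀.re| + 1) * X)
  -- On the unit ball about `z₀` this gives `|Im z| ≤ N`, so for `|k| > N` the imaginary part `Im z
  -- + 2πk` has size at least `2π|k| - |k| ≥ |k|`.
  obtain ⟨N, hN⟩ := exists_nat_ge (|z₀.im| + 1)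
  refine ⟨C, N, hC0, fun z hz k hk => ?_⟩
  have hX' : (1:ℝ) ≤ X := by exact_mod_cast hX
  have hk1 : (N:ℝ) < |(k:ℝ)| := by exact_mod_cast hk
  have hre : |z.re| ≤ |z₀.re| + 1 := by
    have h1 := (Complex.abs_re_le_norm (z - z₀)).trans hz
    rw [Complex.sub_re] at h1
    have := abs_sub_abs_le_abs_sub z.re z₀.re
    linarith
  have him : |z.im| ≤ |z₀.im| + 1 := by
    have h1 := (Complex.abs_im_le_norm (z - z₀)).trans hz
    rw [Complex.sub_im] at h1
    have := abs_sub_abs_le_abs_sub z.im z₀.im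
    linarith
  set w := (z + k * (2 * Real.pi * Complex.I)) * X with hw
  have hwre : w.re = z.re * X := by simp [hw]
  have hwim : w.im = (z.im + k * (2 * Real.pi)) * X := by simp [hw]
  have habs : |(k:ℝ)| ≤ |w.im| := by
    rw [hwim, abs_mul, Nat.abs_cast]
    have h2 : |(k:ℝ)| ≤ |z.im + k * (2 * Real.pi)| := by
      have h3 : |(k:ℝ) * (2 * Real.pi)| = |(k:ℝ)| * (2 * Real.pi) := by
        rw [abs_mul, abs_of_pos Real.two_pi_pos]
      have h4 := abs_sub_abs_le_abs_sub ((k:ℝ) * (2 * Real.pi)) (-z.im)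
      rw [abs_neg, h3, sub_neg_eq_add, add_comm _ z.im] at h4
      nlinarith [Real.pi_gt_three, abs_nonneg (k:ℝ)]
    nlinarith [abs_nonneg (z.im + k * (2 * Real.pi))]
  have hk0 : 0 < |(k:ℝ)| := lt_of_le_of_lt (Nat.cast_nonneg N) hk1
  have him0 : w.im ≠ 0 := abs_pos.1 (hk0.trans_le habs)
  refine (hC w him0 ?_).trans ?_
  · rw [hwre, abs_mul, Nat.abs_cast]
    gcongr
  · rw [← sq_abs w.im, ← sq_abs (k:ℝ), mul_one_div]
    gcongr

theorem summable_UWeight_translate (hu : ContDiff ℝ ∞ u) (hδ : δ ≤ 1)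
    (hs : Function.support u ⊆ Set.Icc (Real.exp 1) (Real.exp (1 + δ)))
    (hn : vWeight u 0 = 1) {X : ℕ} (hX : 1 ≤ X) (z : ℂ) :
    Summable fun k : ℤ => UWeight u ((z + k * (2 * Real.pi * Complex.I)) * X) := by
  obtain ⟨C, N, -, h⟩ := norm_UWeight_translate_le hu hδ hs hn hX z
  refine Summable.of_norm_bounded_eventually
    (g := fun k : ℤ => C * (1 / (k : ℝ) ^ 2))
    ((Real.summable_one_div_int_pow.2 one_lt_two).mul_left C) ?_
  rw [Filter.eventually_cofinite]
  refine (Set.finite_Icc (-(N:ℤ)) N).subset fun k hk => ?_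
  by_contra hk'
  rw [Set.mem_Icc, ← abs_le, not_le] at hk'
  exact hk (h z (by simp) k hk')

theorem differentiableOn_tsum_UWeight_translate (hu : ContDiff ℝ ∞ u) (hδ : δ ≤ 1)
    (hs : Function.support u ⊆ Set.Icc (Real.exp 1) (Real.exp (1 + δ)))
    (hn : vWeight u 0 = 1) {X : ℕ} (hX : 1 ≤ X) :
    DifferentiableOn ℂ
      (fun z => ∑' k : ℤ, UWeight u ((z + k * (2 * Real.pi * Complex.I)) * X))
      periodicSlitPlane := by
  have hXpos : (0:ℝ) < X := by exact_mod_cast hX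
  have hdiff (k : ℤ) : DifferentiableOn ℂ
      (fun z => UWeight u ((z + k * (2 * Real.pi * Complex.I)) * X)) periodicSlitPlane := by
    refine (UWeight_differentiableOn hu hδ hs hn).comp (by fun_prop) fun z hz => ?_
    simpa using mul_ofReal_mem_slitPlane (one_sub_exp_neg_mem_slitPlane_iff.1 hz k) hXpos
  intro z₀ hz₀
  obtain ⟨C, N, hC, h⟩ := norm_UWeight_translate_le hu hδ hs hn hX z₀
  obtain ⟨r, hr, hball⟩ := Metric.nhds_basis_closedBall.mem_iff.1
    (isOpen_periodicSlitPlane.mem_nhds hz₀)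
  have hsub : Metric.ball z₀ (min r 1) ⊆ Metric.closedBall z₀ r :=
    Metric.ball_subset_closedBall.trans (Metric.closedBall_subset_closedBall (min_le_left _ _))
  have hbd (k : ℤ) := (isCompact_closedBall z₀ r).exists_bound_of_continuousOn
    ((hdiff k).continuousOn.mono hball)
  choose B hB using hbd
  -- The terms with `|k| ≤ N` have no uniform decay bound; they are bounded individually by
  -- compactness of the closed ball.
  have hsum : Summable fun k : ℤ => C * (1 / (k : ℝ) ^ 2) +
      if k ∈ Finset.Icc (-(N:ℤ)) N then |B k| else 0 := by
    refine ((Real.summable_one_div_int_pow.2 one_lt_two).mul_left C).add ?_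
    exact summable_of_ne_finset_zero (s := Finset.Icc (-(N:ℤ)) N) fun k hk => if_neg hk
  refine (DifferentiableOn.differentiableAt (s := Metric.ball z₀ (min r 1))
    (Complex.differentiableOn_tsum_of_summable_norm hsum
      (fun k => (hdiff k).mono (hsub.trans hball)) Metric.isOpen_ball fun k w hw => ?_)
    (Metric.ball_mem_nhds z₀ (by positivity))).differentiableWithinAt
  split_ifs with hk
  · exact ((hB k w (hsub hw)).trans (le_abs_self _)).trans (le_add_of_nonneg_left (by positivity))
  · rw [add_zero]
    rw [Finset.mem_Icc, ← abs_le, not_le] at hk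
    refine h w ?_ k hk
    rw [← dist_eq_norm]
    exact (Metric.mem_ball.1 hw).le.trans (min_le_right _ _)

/-- Poisson summation for `f(y) = K(y/X)/X · e^{-zy}`: its Fourier transform at `k` is `U((z +
2πik)X)`, and at integers `f` is a sharp cutoff, 0 for `n ≤ X` and `e^{-zn}/n` for `n > X`. -/
theorem tsum_UWeight_translate_of_re_pos (hu : ContDiff ℝ ∞ u) {X : ℕ} (hX : 1 ≤ X)
    (hδ : δ * X ≤ 1) (hδ1 : δ ≤ 1)
    (hs : Function.support u ⊆ Set.Icc (Real.exp 1) (Real.exp (1 + δ)))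
    (hn : vWeight u 0 = 1) {z : ℂ} (hz : 0 < z.re) :
    ∑' k : ℤ, UWeight u ((z + k * (2 * Real.pi * Complex.I)) * X) =
      ∑' n : ℕ, if n ≤ X then 0 else Complex.exp (-z) ^ n / n := by
  have hXpos : (0:ℝ) < X := by exact_mod_cast hX
  have hXC : (X:ℂ) ≠ 0 := by exact_mod_cast hXpos.ne'
  set f : ℝ → ℂ := fun y => laplaceKernel u (y / X) / X * Complex.exp (-(z * y)) with hf
  have hfc : Continuous f := by
    have := (laplaceKernel_contDiff hu hs).continuous
    fun_prop
  have hfourier (ξ : ℝ) : FourierTransform.fourier f ξ =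
      UWeight u ((z + ξ * (2 * Real.pi * Complex.I)) * X) := by
    rw [Real.fourier_real_eq_integral_exp_smul,
      ← integral_laplaceKernel_mul_exp hu hδ1 hs hn (by simpa using mul_pos hz hXpos)]
    have h := MeasureTheory.Measure.integral_comp_div (fun t : ℝ => laplaceKernel u t *
      Complex.exp (-((z + ξ * (2 * Real.pi * Complex.I)) * X * t))) (X:ℝ)
    rw [abs_of_pos hXpos, Complex.real_smul] at h
    rw [← mul_right_inj' hXC]
    rw [Complex.ofReal_natCast] at h
    rw [← h, ← MeasureTheory.integral_const_mul]
    congr 1; ext y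
    rw [hf, smul_eq_mul]
    have e1 : (z + ξ * (2 * Real.pi * Complex.I)) * X * ((y / X : ℝ) : ℂ) =
        (z + ξ * (2 * Real.pi * Complex.I)) * y := by
      push_cast; field_simp
    have e2 : Complex.exp (-((z + ξ * (2 * Real.pi * Complex.I)) * y)) =
        Complex.exp (((-2 * Real.pi * y * ξ : ℝ) : ℂ) * Complex.I) * Complex.exp (-(z * y)) := by
      rw [← Complex.exp_add]; congr 1; push_cast; ring
    rw [e1, e2]
    field_simp
  have hdecay : f =O[Filter.cocompact ℝ] fun x : ℝ => |x| ^ (-2 : ℝ) := by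
    rw [cocompact_eq_atBot_atTop, Asymptotics.isBigO_sup]
    constructor
    · refine Filter.EventuallyEq.trans_isBigO (f₂ := fun _ => (0:ℂ)) ?_
        (Asymptotics.isBigO_zero _ _)
      filter_upwards [Filter.eventually_le_atBot 0] with x hx
      have : x / X ≤ 0 := div_nonpos_of_nonpos_of_nonneg hx hXpos.le
      simp [hf, laplaceKernel_eq_zero hu.continuous hs (this.trans zero_le_one)]
    · have h1 : f =O[Filter.atTop] fun x : ℝ => Real.exp (-z.re * x) := by
        refine Asymptotics.IsBigO.of_bound 1 ?_
        filter_upwards [Filter.eventually_ge_atTop (2 * X : ℝ)] with x hx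
        have hx2 : 2 ≤ x / X := by rwa [le_div_iff₀ hXpos]
        have hxpos : 1 ≤ x := by
          have : (1:ℝ) ≤ X := by exact_mod_cast hX
          linarith
        simp only [hf]
        rw [laplaceKernel_eq_inv hs hn (by linarith), norm_mul, Complex.norm_exp, one_mul,
          Real.norm_of_nonneg (Real.exp_nonneg _)]
        have h3 : (-(z * x)).re = -z.re * x := by simp
        have h4 : ((x / X : ℝ) : ℂ)⁻¹ / X = ((x⁻¹ : ℝ) : ℂ) := by
          push_cast; field_simp
        rw [h3, h4, Complex.norm_real, Real.norm_of_nonneg (by positivity)]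
        exact mul_le_of_le_one_left (Real.exp_nonneg _) (inv_le_one_of_one_le₀ hxpos)
      have h2 := (isLittleO_exp_neg_mul_rpow_atTop hz (-2)).isBigO
      refine (h1.trans h2).trans (Filter.EventuallyEq.isBigO ?_)
      filter_upwards [Filter.eventually_ge_atTop 0] with x hx
      rw [abs_of_nonneg hx]
  have hpoisson := Real.tsum_eq_tsum_fourier_of_rpow_decay_of_summable hfc one_lt_two hdecay
    (by
      have := summable_UWeight_translate hu hδ1 hs hn hX z
      refine this.congr fun k => ?_
      rw [hfourier]; simp) 0
  have hL : ∑' k : ℤ, UWeight u ((z + k * (2 * Real.pi * Complex.I)) * X) =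
      ∑' n : ℤ, f (0 + n) := by
    rw [hpoisson]
    refine tsum_congr fun k => ?_
    rw [hfourier]
    simp
  rw [hL]
  simp only [zero_add]
  have hzero (y : ℝ) (hy : y ≤ X) : f y = 0 := by
    have : y / X ≤ 1 := by rwa [div_le_one hXpos]
    simp [hf, laplaceKernel_eq_zero hu.continuous hs this]
  rw [← Function.Injective.tsum_eq (g := ((↑) : ℕ → ℤ)) Nat.cast_injective]
  · refine tsum_congr fun n => ?_
    split_ifs with hnX
    · exact hzero _ (by exact_mod_cast hnX)
    · push Not at hnX
      have hn1 : (X:ℝ) + 1 ≤ n := by exact_mod_cast hnX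
      have hn0 : (n:ℂ) ≠ 0 := by exact_mod_cast (by omega : n ≠ 0)
      -- The support condition enters here: `n ≥ X + 1 ≥ X + δX`, so every integer beyond `X` is
      -- already past the transition range.
      have hge : 1 + δ ≤ ((n:ℤ):ℝ) / X := by
        rw [le_div_iff₀ hXpos, Int.cast_natCast]
        linarith
      simp only [hf]
      rw [laplaceKernel_eq_inv hs hn hge, ← Complex.exp_nat_mul]
      push_cast
      rw [mul_comm (n:ℂ) (-z), neg_mul]
      field_simp
  · intro k hk
    by_contra hk'
    refine hk (hzero _ ?_)
    have : k < 0 := by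
      by_contra h
      exact hk' ⟨k.toNat, by simp; omega⟩
    have : (k:ℝ) < 0 := by exact_mod_cast this
    linarith

/-- For `Re z > 0` the lattice sum is the logarithmic series with its first `X` terms removed. Both
sides are analytic on the connected cut plane, so the identity persists there; the right side is
entire, hence has limits on the cuts. -/
theorem exp_neg_tsum_UWeight_translate (hu : ContDiff ℝ ∞ u) {X : ℕ} (hX : 1 ≤ X)
    (hδ : δ * X ≤ 1) (hδ1 : δ ≤ 1)
    (hs : Function.support u ⊆ Set.Icc (Real.exp 1) (Real.exp (1 + δ)))
    (hn : vWeight u 0 = 1) {z : ℂ} (hz : z ∈ periodicSlitPlane) :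
    Complex.exp (-∑' k : ℤ, UWeight u ((z + k * (2 * Real.pi * Complex.I)) * X)) =
      (1 - Complex.exp (-z)) *
        Complex.exp (∑ n ∈ Finset.Icc 1 X, Complex.exp (-z) ^ n / n) := by
  have hA : AnalyticOnNhd ℂ (fun z => Complex.exp
      (-∑' k : ℤ, UWeight u ((z + k * (2 * Real.pi * Complex.I)) * X))) periodicSlitPlane :=
    (differentiableOn_tsum_UWeight_translate hu hδ1 hs hn hX).neg.cexp.analyticOnNhd
      isOpen_periodicSlitPlane
  have hB : AnalyticOnNhd ℂ (fun z => (1 - Complex.exp (-z)) *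
      Complex.exp (∑ n ∈ Finset.Icc 1 X, Complex.exp (-z) ^ n / n)) periodicSlitPlane := by
    refine DifferentiableOn.analyticOnNhd (Differentiable.differentiableOn ?_)
      isOpen_periodicSlitPlane
    fun_prop
  refine hA.eqOn_of_preconnected_of_eventuallyEq hB isPreconnected_periodicSlitPlane
    (mem_periodicSlitPlane_of_re_pos (z := 1) (by simp)) ?_ hz
  filter_upwards [(isOpen_lt continuous_const Complex.continuous_re).mem_nhds
    (show (1:ℂ) ∈ {w : ℂ | 0 < w.re} by simp)] with w hw
  have hw : 0 < w.re := hw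
  rw [tsum_UWeight_translate_of_re_pos hu hX hδ hδ1 hs hn hw]
  have hlt : ‖Complex.exp (-w)‖ < 1 := by
    rw [Complex.norm_exp, Real.exp_lt_one_iff]; simpa using hw
  have h1 := Complex.hasSum_taylorSeries_neg_log hlt
  have h2 : HasSum (fun n : ℕ => if n ∈ Finset.Icc 1 X then Complex.exp (-w) ^ n / n else 0)
      (∑ n ∈ Finset.Icc 1 X, Complex.exp (-w) ^ n / n) := by
    have := hasSum_sum_of_ne_finset_zero (s := Finset.Icc 1 X) (f := fun n : ℕ =>
      if n ∈ Finset.Icc 1 X then Complex.exp (-w) ^ n / n else 0) (fun n hn => if_neg hn)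
      (L := SummationFilter.unconditional ℕ)
    rwa [Finset.sum_congr rfl fun n hn => if_pos hn] at this
  have h3 := (h1.sub h2).tsum_eq
  have h4 : ∀ n : ℕ, Complex.exp (-w) ^ n / n -
      (if n ∈ Finset.Icc 1 X then Complex.exp (-w) ^ n / n else 0) =
      if n ≤ X then 0 else Complex.exp (-w) ^ n / n := by
    intro n
    -- The Taylor series is indexed from 0; its term there is a division by zero and has the value
    -- 0.
    rcases Nat.eq_zero_or_pos n with rfl | h
    · simp
    · by_cases hnX : n ≤ X
      · simp [hnX, Nat.one_le_iff_ne_zero.2 h.ne']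
      · simp [hnX]
  rw [tsum_congr h4] at h3
  rw [h3, neg_sub, sub_neg_eq_add, add_comm, Complex.exp_add, Complex.exp_log]
  intro h0
  have : Complex.exp (-w) = 1 := by linear_combination -h0
  rw [this] at hlt
  simp at hlt

end Sum

/-! ### Dirichlet characters and sums over monic polynomials. -/

section MonicSums

open Polynomial

variable {F : Type*} [Field F]

theorem Polynomial.Monic.eq_of_irreducible_of_dvd_pow {P Q : F[X]} (hP : P.Monic)
    (hPi : Irreducible P) (hQ : Q.Monic) (hQi : Irreducible Q) {n : ℕ} (h : P ∣ Q ^ n) : P = Q :=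
  eq_of_monic_of_associated hP hQ (hPi.associated_of_dvd hQi (hPi.prime.dvd_of_dvd_pow h))

section

variable {R : F[X]}

theorem DirichletChar.val_mul (χ : DirichletChar R) (A B : F[X]) :
    DirichletChar.val χ (A * B) = DirichletChar.val χ A * DirichletChar.val χ B := by
  simp [DirichletChar.val]

theorem DirichletChar.val_one (χ : DirichletChar R) : DirichletChar.val χ 1 = 1 := by
  simp [DirichletChar.val]

theorem mk_degreeLT_surjective (hR : R.Monic) {n : ℕ} (hn : R.natDegree ≤ n) :
    Function.Surjective fun B : degreeLT F n =>
      Ideal.Quotient.mk (Ideal.span {R}) (B : F[X]) := by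
  intro r
  obtain ⟨A, rfl⟩ := Ideal.Quotient.mk_surjective r
  refine ⟨⟨A %ₘ R, mem_degreeLT.2 ?_⟩, ?_⟩
  · refine (degree_modByMonic_lt A hR).trans_le ?_
    rw [degree_eq_natDegree hR.ne_zero]
    exact_mod_cast hn
  · rw [Ideal.Quotient.mk_eq_mk_iff_sub_mem, Ideal.mem_span_singleton]
    refine ⟨-(A /ₘ R), ?_⟩
    have h := modByMonic_add_div A R
    change A %ₘ R - A = _
    linear_combination h

/-- A primitive character of modulus different from `1` is not the trivial character. -/
theorem DirichletChar.IsPrimitive.ne_one {χ : DirichletChar R} (hχ : DirichletChar.IsPrimitive χ)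
    (hR : R.Monic) (hR1 : R ≠ 1) : χ ≠ 1 := by
  rintro rfl
  refine hχ ⟨1, ⟨monic_one, one_dvd R, 1, fun A => ?_⟩, ?_⟩
  -- Modulo 1 the quotient is the zero ring, in which every class equals 1 and is a unit; thus the
  -- trivial character is induced from modulus 1.
  · have htriv : DirichletChar.val (1 : DirichletChar (1 : F[X])) A = 1 := by
      have : Subsingleton (F[X] ⧸ Ideal.span {(1 : F[X])}) :=
        Ideal.Quotient.subsingleton_iff.2 (Ideal.span_singleton_one)
      rw [DirichletChar.val, Subsingleton.elim (Ideal.Quotient.mk _ A) 1, map_one]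
    rw [htriv, DirichletChar.val]
    have hiff : IsUnit (Ideal.Quotient.mk (Ideal.span {R}) A) ↔ IsCoprime A R := by
      rw [isUnit_iff_exists_inv]
      constructor
      · rintro ⟨b, hb⟩
        obtain ⟨B, rfl⟩ := Ideal.Quotient.mk_surjective b
        rw [← map_mul, ← map_one (Ideal.Quotient.mk _), Ideal.Quotient.mk_eq_mk_iff_sub_mem,
          Ideal.mem_span_singleton] at hb
        obtain ⟨C, hC⟩ := hb
        exact ⟨B, -C, by linear_combination hC⟩
      · rintro ⟨B, C, h⟩
        refine ⟨Ideal.Quotient.mk _ B, ?_⟩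
        rw [← map_mul, ← map_one (Ideal.Quotient.mk _), Ideal.Quotient.mk_eq_mk_iff_sub_mem,
          Ideal.mem_span_singleton]
        exact ⟨-C, by linear_combination h⟩
    split_ifs with h
    · exact MulChar.one_apply (hiff.2 h)
    · exact MulChar.map_nonunit _ (mt hiff.1 h)
  · rw [natDegree_one]
    exact Nat.pos_of_ne_zero fun h => hR1 (hR.natDegree_eq_zero.1 h)

end

variable [Fintype F]

theorem mem_monicLE {n : ℕ} {A : F[X]} : A ∈ monicLE F n ↔ A.Monic ∧ A.natDegree ≤ n := by
  simp [monicLE]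

open Classical in
/-- The finite set of monic polynomials of degree `n`. -/
noncomputable def monicEq (F : Type*) [Field F] [Fintype F] (n : ℕ) : Finset F[X] :=
  (monicLE F n).filter fun A => A.natDegree = n

theorem mem_monicEq {n : ℕ} {A : F[X]} : A ∈ monicEq F n ↔ A.Monic ∧ A.natDegree = n := by
  simp only [monicEq, Finset.mem_filter, mem_monicLE]
  constructor
  · rintro ⟨⟨h, -⟩, h2⟩; exact ⟨h, h2⟩
  · rintro ⟨h, h2⟩; exact ⟨⟨h, h2.le⟩, h2⟩

theorem sum_monicLE {M : Type*} [AddCommMonoid M] (g : F[X] → M) (X : ℕ) :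
    ∑ A ∈ monicLE F X, g A = ∑ n ∈ Finset.range (X + 1), ∑ A ∈ monicEq F n, g A := by
  classical
  rw [← Finset.sum_fiberwise_of_maps_to (s := monicLE F X) (t := Finset.range (X + 1))
    (g := fun A => A.natDegree)]
  · refine Finset.sum_congr rfl fun n hn => Finset.sum_congr ?_ fun _ _ => rfl
    ext A
    rw [Finset.mem_range] at hn
    rw [Finset.mem_filter, mem_monicLE, mem_monicEq]
    constructor
    · rintro ⟨⟨h, -⟩, h2⟩; exact ⟨h, h2⟩
    · rintro ⟨h, h2⟩; exact ⟨⟨h, by omega⟩, h2⟩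
  · intro A hA
    rw [mem_monicLE] at hA
    rw [Finset.mem_range]
    omega

theorem finite_degreeLT (n : ℕ) : Finite (degreeLT F n) :=
  Finite.of_equiv _ (degreeLTEquiv F n).symm.toEquiv

theorem sum_monicEq {M : Type*} [AddCommMonoid M] (g : F[X] → M) (n : ℕ)
    [Fintype (degreeLT F n)] :
    ∑ A ∈ monicEq F n, g A = ∑ B : degreeLT F n, g (X ^ n + (B : F[X])) := by
  symm
  refine Finset.sum_bij (fun B _ => X ^ n + (B : F[X])) (fun B _ => ?_) (fun B _ C _ h => ?_)
    (fun A hA => ?_) (fun _ _ => rfl)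
  · exact mem_monicEq.2 ((monicEquivDegreeLT n).symm B).2
  · exact Subtype.ext (add_left_cancel h)
  · have := (monicEquivDegreeLT n).symm_apply_apply ⟨A, mem_monicEq.1 hA⟩
    exact ⟨_, Finset.mem_univ _, congrArg Subtype.val this⟩

theorem card_monicEq (n : ℕ) : (monicEq F n).card = Fintype.card F ^ n := by
  have := finite_degreeLT (F := F) n
  cases nonempty_fintype (degreeLT F n)
  rw [Finset.card_eq_sum_ones, sum_monicEq]
  simp only [Finset.sum_const, Finset.card_univ, smul_eq_mul, mul_one]
  rw [Fintype.card_congr (degreeLTEquiv F n).toEquiv]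
  simp

theorem absNorm_eq {A : F[X]} (hA : A ≠ 0) :
    absNorm A = (Fintype.card F : ℝ) ^ A.natDegree := by
  rw [absNorm, cardPowDegree_nonzero _ hA]
  push_cast; rfl

theorem log_absNorm {A : F[X]} (hA : A ≠ 0) :
    Real.log (absNorm A) = A.natDegree * Real.log (Fintype.card F) := by
  rw [absNorm_eq hA, Real.log_pow]

theorem log_card_pos : 0 < Real.log (Fintype.card F) :=
  Real.log_pos (by exact_mod_cast Fintype.one_lt_card)

theorem absNorm_cpow {A : F[X]} (hA : A ≠ 0) (s : ℂ) :
    (absNorm A : ℂ) ^ s = (Complex.exp (-(s * Real.log (Fintype.card F))) ^ A.natDegree)⁻¹ := by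
  have h0 : (0:ℝ) < Fintype.card F := by exact_mod_cast Fintype.card_pos
  have h1 : 0 < absNorm A := by rw [absNorm_eq hA]; positivity
  rw [Complex.cpow_def_of_ne_zero (by exact_mod_cast h1.ne'), ← Complex.ofReal_log h1.le,
    log_absNorm hA, ← Complex.exp_nat_mul, ← Complex.exp_neg]
  congr 1
  push_cast
  ring

/-! ### The von Mangoldt function -/

theorem vonMangoldt_pow {P : F[X]} (hP : P.Monic) (hPi : Irreducible P) {e : ℕ} (he : 1 ≤ e) :
    vonMangoldt (P ^ e) = Real.log (absNorm P) := by
  have h : ∃ Q : F[X], Q.Monic ∧ Irreducible Q ∧ ∃ f : ℕ, 1 ≤ f ∧ P ^ e = Q ^ f :=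
    ⟨P, hP, hPi, e, he, rfl⟩
  rw [vonMangoldt, dif_pos h]
  obtain ⟨h1, h2, f, hf, h3⟩ := h.choose_spec
  congr 2
  refine h1.eq_of_irreducible_of_dvd_pow h2 hP hPi (n := e) ?_
  exact (dvd_pow_self _ (by omega)).trans h3.symm.dvd

theorem vonMangoldt_one : vonMangoldt (1 : F[X]) = 0 := by
  rw [vonMangoldt, dif_neg]
  rintro ⟨P, -, hP, e, he, h⟩
  exact hP.not_isUnit (isUnit_of_dvd_one (h ▸ dvd_pow_self P (by omega)))

open Classical in
/-- The monic divisors of a polynomial. -/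
noncomputable def monicDivisors (A : F[X]) : Finset F[X] :=
  (monicLE F A.natDegree).filter (· ∣ A)

theorem mem_monicDivisors {A D : F[X]} (hA : A ≠ 0) : D ∈ monicDivisors A ↔ D.Monic ∧ D ∣ A := by
  simp only [monicDivisors, Finset.mem_filter, mem_monicLE]
  constructor
  · rintro ⟨⟨h, -⟩, h2⟩; exact ⟨h, h2⟩
  · rintro ⟨h, h2⟩; exact ⟨⟨h, natDegree_le_of_dvd h2 hA⟩, h2⟩

/-- Passing from `B` to `P * B` creates exactly one new prime power divisor, `P^(m+1)` with `m` the
multiplicity of `P` in `B`. -/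
theorem sum_vonMangoldt_monicDivisors_mul {P B : F[X]} (hP : P.Monic) (hPi : Irreducible P)
    (hB : B.Monic) :
    ∑ D ∈ monicDivisors (P * B), vonMangoldt D =
      Real.log (absNorm P) + ∑ D ∈ monicDivisors B, vonMangoldt D := by
  classical
  have hPB : P * B ≠ 0 := (hP.mul hB).ne_zero
  have hfin : FiniteMultiplicity P B := finiteMultiplicity_of_degree_pos_of_monic
    (natDegree_pos_iff_degree_pos.1 hPi.natDegree_pos) hP hB.ne_zero
  have hsub : monicDivisors B ⊆ monicDivisors (P * B) := fun D hD => by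
    rw [mem_monicDivisors hB.ne_zero] at hD
    exact (mem_monicDivisors hPB).2 ⟨hD.1, hD.2.mul_left P⟩
  rw [← Finset.sum_sdiff hsub]
  congr 1
  set m := multiplicity P B with hm
  have hnot : ¬ P ^ (m + 1) ∣ B := hfin.not_pow_dvd_of_multiplicity_lt (Nat.lt_succ_self m)
  rw [Finset.sum_eq_single (P ^ (m + 1)), vonMangoldt_pow hP hPi (by omega)]
  · intro D hD hDne
    rw [Finset.mem_sdiff, mem_monicDivisors hPB, mem_monicDivisors hB.ne_zero] at hD
    obtain ⟨⟨hDm, hDd⟩, hDB⟩ := hD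
    rw [vonMangoldt, dif_neg]
    rintro ⟨Q, hQ, hQi, e, he, rfl⟩
    have hDB : ¬ Q ^ e ∣ B := fun h => hDB ⟨hDm, h⟩
    by_cases hQP : Q = P
    · subst hQP
      obtain ⟨f, rfl⟩ : ∃ f, e = f + 1 := ⟨e - 1, by omega⟩
      have h1 : Q ^ f ∣ B := by
        rw [pow_succ', mul_dvd_mul_iff_left hQ.ne_zero] at hDd
        exact hDd
      have h2 : f ≤ m := hfin.le_multiplicity_of_pow_dvd h1
      have h3 : ¬ f + 1 ≤ m := fun h =>
        hDB ((pow_dvd_pow Q h).trans (pow_multiplicity_dvd Q B))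
      have : f = m := by omega
      exact hDne (by rw [this])
    · refine hDB (IsCoprime.dvd_of_dvd_mul_left ?_ hDd)
      refine IsCoprime.pow_left ((hQi.coprime_iff_not_dvd).2 fun h => hQP ?_)
      exact hQ.eq_of_irreducible_of_dvd_pow hQi hP hPi (n := 1) (by simpa using h)
  · intro h
    refine absurd ?_ h
    rw [Finset.mem_sdiff, mem_monicDivisors hPB, mem_monicDivisors hB.ne_zero]
    refine ⟨⟨hP.pow _, ?_⟩, fun h => hnot h.2⟩
    rw [pow_succ']
    exact mul_dvd_mul_left P (pow_multiplicity_dvd P B)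

/-- `∑_{D ∣ A} Λ(D) = log |A|`. -/
theorem sum_vonMangoldt_monicDivisors {A : F[X]} (hA : A.Monic) :
    ∑ D ∈ monicDivisors A, vonMangoldt D = Real.log (absNorm A) := by
  induction h : A.natDegree using Nat.strong_induction_on generalizing A with
  | _ n ih =>
    by_cases h1 : A = 1
    · subst h1
      rw [Finset.sum_eq_zero, log_absNorm one_ne_zero]
      · simp
      · intro D hD
        rw [mem_monicDivisors one_ne_zero] at hD
        rw [hD.1.eq_one_of_isUnit (isUnit_of_dvd_one hD.2), vonMangoldt_one]
    · obtain ⟨P, hP, hPi, B, rfl⟩ := exists_monic_irreducible_factor A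
        (fun hu => h1 (hA.eq_one_of_isUnit hu))
      have hB : B.Monic := hP.of_mul_monic_left hA
      have hdeg := hP.natDegree_mul hB
      have := hPi.natDegree_pos
      rw [sum_vonMangoldt_monicDivisors_mul hP hPi hB, ih B.natDegree (by omega) hB rfl,
        log_absNorm hP.ne_zero, log_absNorm hB.ne_zero, log_absNorm hA.ne_zero, hdeg]
      push_cast
      ring

/-! ### Character sums -/

variable {R : F[X]} (χ : DirichletChar R)

/-- The sum of `χ(A)` over monic `A` of degree `n`. -/
noncomputable def charSum (n : ℕ) : ℂ := ∑ A ∈ monicEq F n, DirichletChar.val χ A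

/-- The sum of `χ(A) Λ(A)` over monic `A` of degree `n`. -/
noncomputable def charMangoldtSum (n : ℕ) : ℂ :=
  ∑ A ∈ monicEq F n, DirichletChar.val χ A * (vonMangoldt A : ℂ)

theorem monicEq_zero : monicEq F 0 = {1} := by
  ext A
  rw [mem_monicEq, Finset.mem_singleton]
  constructor
  · rintro ⟨h, h0⟩; exact h.natDegree_eq_zero.1 h0
  · rintro rfl; exact ⟨monic_one, natDegree_one⟩

theorem charSum_zero : charSum χ 0 = 1 := by
  simp [charSum, monicEq_zero, DirichletChar.val_one]

theorem charMangoldtSum_zero : charMangoldtSum χ 0 = 0 := by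
  simp [charMangoldtSum, monicEq_zero, vonMangoldt_one]

/-- Polynomials of degree below `n` represent every residue class, so the sum is unchanged when all
arguments are shifted by a class `r`. Averaging over `r` gives complete sums of a nontrivial
character. -/
theorem charSum_eq_zero (hR : R.Monic) (hχ : χ ≠ 1) {n : ℕ} (hn : R.natDegree ≤ n) :
    charSum χ n = 0 := by
  have := finite_degreeLT (F := F) n
  cases nonempty_fintype (degreeLT F n)
  have hsurj := mk_degreeLT_surjective hR hn
  have := Finite.of_surjective _ hsurj
  cases nonempty_fintype (F[X] ⧸ Ideal.span {R})
  rw [charSum, sum_monicEq]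
  have htrans (r : F[X] ⧸ Ideal.span {R}) :
      ∑ B : degreeLT F n, DirichletChar.val χ (X ^ n + (B : F[X])) = ∑ B : degreeLT F n,
        χ (Ideal.Quotient.mk (Ideal.span {R}) (X ^ n + (B : F[X])) + r) := by
    obtain ⟨C, hC⟩ := hsurj r
    rw [← Equiv.sum_comp (Equiv.addRight C)]
    refine Finset.sum_congr rfl fun B _ => ?_
    rw [DirichletChar.val, ← hC, ← map_add]
    simp [add_assoc]
  have hcard : (Fintype.card (F[X] ⧸ Ideal.span {R}) : ℂ) *
      ∑ B : degreeLT F n, DirichletChar.val χ (X ^ n + (B : F[X])) = 0 := by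
    rw [← nsmul_eq_mul, ← Finset.card_univ, ← Finset.sum_const,
      Finset.sum_congr rfl fun r _ => htrans r, Finset.sum_comm]
    refine Finset.sum_eq_zero fun B _ => ?_
    refine (Equiv.sum_comp (Equiv.addLeft
      (Ideal.Quotient.mk (Ideal.span {R}) (X ^ n + (B : F[X])))) fun r => χ r).trans ?_
    exact MulChar.sum_eq_zero_of_ne_one hχ
  refine (mul_eq_zero.1 hcard).resolve_left ?_
  exact_mod_cast Fintype.card_ne_zero

/-- Multiply `∑_{D ∣ A} Λ(D) = log |A|` by `χ(A)`, sum over degree `n` and write `A = DE`. This is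
the logarithmic derivative of `L` read coefficient by coefficient. -/
theorem natCast_mul_charSum (n : ℕ) :
    (n : ℂ) * Real.log (Fintype.card F) * charSum χ n =
      ∑ p ∈ Finset.HasAntidiagonal.antidiagonal n, charMangoldtSum χ p.1 * charSum χ p.2 := by
  have h1 : (n : ℂ) * Real.log (Fintype.card F) * charSum χ n = ∑ A ∈ monicEq F n,
      ∑ D ∈ monicDivisors A, DirichletChar.val χ A * (vonMangoldt D : ℂ) := by
    rw [charSum, Finset.mul_sum]
    refine Finset.sum_congr rfl fun A hA => ?_
    rw [mem_monicEq] at hA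
    rw [← Finset.mul_sum, ← Complex.ofReal_sum, sum_vonMangoldt_monicDivisors hA.1,
      log_absNorm hA.1.ne_zero, hA.2]
    push_cast
    ring
  rw [h1]
  simp only [charMangoldtSum, charSum, Finset.sum_mul_sum]
  rw [Finset.sum_sigma']
  have h2 (p : ℕ × ℕ) : ∑ D ∈ monicEq F p.1, ∑ E ∈ monicEq F p.2,
      DirichletChar.val χ D * (vonMangoldt D : ℂ) * DirichletChar.val χ E =
      ∑ q ∈ monicEq F p.1 ×ˢ monicEq F p.2,
        DirichletChar.val χ q.1 * (vonMangoldt q.1 : ℂ) * DirichletChar.val χ q.2 := by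
    rw [Finset.sum_product]
  simp only [h2]
  rw [Finset.sum_sigma']
  symm
  refine Finset.sum_bij (fun x _ => ⟨x.2.1 * x.2.2, x.2.1⟩) ?_ ?_ ?_ ?_
  · rintro ⟨⟨k, l⟩, D, E⟩ h
    simp only [Finset.mem_sigma, Finset.HasAntidiagonal.mem_antidiagonal, Finset.mem_product, mem_monicEq] at h ⊢
    obtain ⟨hkl, ⟨hD, rfl⟩, hE, rfl⟩ := h
    refine ⟨⟨hD.mul hE, by rw [hD.natDegree_mul hE, hkl]⟩, ?_⟩
    exact (mem_monicDivisors (hD.mul hE).ne_zero).2 ⟨hD, dvd_mul_right D E⟩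
  · rintro ⟨⟨k, l⟩, D, E⟩ h ⟨⟨k', l'⟩, D', E'⟩ h' heq
    simp only [Finset.mem_sigma, Finset.HasAntidiagonal.mem_antidiagonal, Finset.mem_product, mem_monicEq] at h h'
    obtain ⟨hkl, ⟨hD, rfl⟩, hE, rfl⟩ := h
    obtain ⟨hkl', ⟨hD', rfl⟩, hE', rfl⟩ := h'
    simp only [Sigma.mk.injEq, heq_eq_eq] at heq
    obtain ⟨h3, rfl⟩ := heq
    obtain rfl := mul_left_cancel₀ hD.ne_zero h3
    rfl
  · rintro ⟨A, D⟩ h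
    simp only [Finset.mem_sigma, mem_monicEq] at h
    obtain ⟨⟨hA, rfl⟩, hD⟩ := h
    replace hD := (mem_monicDivisors hA.ne_zero).1 hD
    obtain ⟨hD, E, rfl⟩ := hD
    have hE : E.Monic := hD.of_mul_monic_left hA
    refine ⟨⟨(D.natDegree, E.natDegree), D, E⟩, ?_, rfl⟩
    simp only [Finset.mem_sigma, Finset.HasAntidiagonal.mem_antidiagonal, Finset.mem_product, mem_monicEq]
    exact ⟨(hD.natDegree_mul hE).symm, ⟨hD, trivial⟩, hE, trivial⟩
  · rintro ⟨⟨k, l⟩, D, E⟩ h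
    simp only [DirichletChar.val_mul]
    ring

end MonicSums

/-! ### Power sums of reciprocal roots -/

section PowerSums

/-- The power series `∑_{k ≥ 1} (β⁻¹ X)^k`. -/
noncomputable def invGeomSeries {K : Type*} [Field K] (β : K) : PowerSeries K :=
  PowerSeries.mk fun k => if k = 0 then 0 else β⁻¹ ^ k

theorem invGeomSeries_mul {K : Type*} [Field K] {β : K} (hβ : β ≠ 0) :
    invGeomSeries β * (PowerSeries.X - PowerSeries.C β) = -PowerSeries.X := by
  ext n
  rcases n with _ | n
  · simp [invGeomSeries]
  · rw [mul_sub, map_sub, PowerSeries.coeff_succ_mul_X, PowerSeries.coeff_mul_C]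
    simp only [invGeomSeries, PowerSeries.coeff_mk, map_neg, PowerSeries.coeff_X]
    rcases n with _ | n
    · simp [hβ]
    · simp [pow_succ, hβ]

open Polynomial in
-- Logarithmic differentiation: each factor contributes `X/(X - β) = -∑_{k ≥ 1} (X/β)^k`, which
-- makes sense as a power series because `β ≠ 0`.
theorem X_mul_derivative_prod_X_sub_C {K : Type*} [Field K] (s : Multiset K) (hs : (0 : K) ∉ s) :
    ((X * derivative (s.map fun β => X - C β).prod : K[X]) : PowerSeries K) =
      -(s.map invGeomSeries).sum * ((s.map fun β => X - C β).prod : K[X]) := by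
  induction s using Multiset.induction_on with
  | empty => simp
  | cons β s ih =>
    rw [Multiset.mem_cons, not_or] at hs
    have h1 := ih hs.2
    have h2 := invGeomSeries_mul (β := β) (fun h => hs.1 h.symm)
    simp only [Multiset.map_cons, Multiset.prod_cons, Multiset.sum_cons, derivative_mul,
      derivative_sub, derivative_X, derivative_C, sub_zero, one_mul]
    simp only [coe_mul, coe_add, coe_sub, coe_X, coe_C] at h1 ⊢
    linear_combination (PowerSeries.X - PowerSeries.C β) * h1 +
      (((s.map fun β => X - C β).prod : K[X]) : PowerSeries K) * h2

open Polynomial in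
/-- Newton's identities in generating function form. -/
theorem eq_neg_sum_inv_roots_pow {K : Type*} [Field K] [IsAlgClosed K] {f : K[X]}
    (hf : f.coeff 0 ≠ 0) {c : ℕ → K}
    (hc : ∀ n : ℕ, (n : K) * f.coeff n =
      ∑ p ∈ Finset.HasAntidiagonal.antidiagonal n, c p.1 * f.coeff p.2) {k : ℕ} (hk : k ≠ 0) :
    c k = -(f.roots.map fun β => β⁻¹ ^ k).sum := by
  have hf0 : f ≠ 0 := by rintro rfl; simp at hf
  have h0 : (0 : K) ∉ f.roots := by
    rw [mem_roots hf0, IsRoot.def, ← coeff_zero_eq_eval_zero]; exact hf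
  have hprod := X_mul_derivative_prod_X_sub_C f.roots h0
  have hsplit : C f.leadingCoeff * (f.roots.map fun β => X - C β).prod = f :=
    C_leadingCoeff_mul_prod_multiset_X_sub_C IsAlgClosed.card_roots_eq_natDegree
  have h1 : ((X * derivative f : K[X]) : PowerSeries K) =
      -(f.roots.map invGeomSeries).sum * (f : PowerSeries K) := by
    have h2 : X * derivative f =
        C f.leadingCoeff * (X * derivative (f.roots.map fun β => X - C β).prod) := by
      conv_lhs => rw [← hsplit]
      rw [derivative_C_mul]
      ring
    rw [h2, coe_mul, hprod]
    have h3 := congrArg (fun g : K[X] => (g : PowerSeries K)) hsplit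
    simp only [coe_mul] at h3
    rw [← h3]
    ring
  have h2 : ((X * derivative f : K[X]) : PowerSeries K) =
      PowerSeries.mk c * (f : PowerSeries K) := by
    ext n
    rw [PowerSeries.coeff_mul]
    simp only [PowerSeries.coeff_mk, coeff_coe]
    rw [← hc n]
    rcases n with _ | n
    · simp
    · rw [coeff_X_mul, coeff_derivative]
      push_cast
      ring
  have hfp : (f : PowerSeries K) ≠ 0 := by
    rw [Ne, coe_eq_zero_iff]; exact hf0
  have h3 := mul_right_cancel₀ hfp (h2.symm.trans h1)
  have h4 := congrArg (PowerSeries.coeff k) h3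
  rw [PowerSeries.coeff_mk, map_neg, map_multiset_sum, Multiset.map_map] at h4
  rw [h4]
  congr 2
  refine Multiset.map_congr rfl fun β _ => ?_
  simp [invGeomSeries, hk]

end PowerSums

/-! ### The `L`-function as a polynomial in `q^{-s}`. -/

section LFunction

open Polynomial

/-- `q ^ (-s)`. -/
noncomputable def qPow (F : Type*) [Fintype F] (s : ℂ) : ℂ := Complex.exp (-(s * Real.log (Fintype.card F)))

theorem qPow_ne_zero {F : Type*} [Fintype F] (s : ℂ) : qPow F s ≠ 0 := Complex.exp_ne_zero _

theorem differentiable_qPow {F : Type*} [Fintype F] : Differentiable ℂ (qPow F) := by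
  unfold qPow; fun_prop

variable {F : Type*} [Field F] [Fintype F]

theorem norm_qPow (s : ℂ) : ‖qPow F s‖ = (Fintype.card F : ℝ) ^ (-s.re) := by
  have h0 : (0:ℝ) < Fintype.card F := by exact_mod_cast Fintype.card_pos
  rw [qPow, Complex.norm_exp, Real.rpow_def_of_pos h0]
  congr 1
  rw [Complex.neg_re, Complex.re_mul_ofReal]
  ring

variable {R : F[X]} (χ : DirichletChar R)

/-- The `L`-function as a polynomial in `q ^ (-s)`. -/
noncomputable def LPoly : ℂ[X] := ∑ n ∈ Finset.range R.natDegree, monomial n (charSum χ n)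

variable {χ}

theorem LPoly_coeff (hR : R.Monic) (hχ : χ ≠ 1) (n : ℕ) : (LPoly χ).coeff n = charSum χ n := by
  rw [LPoly, finsetSum_coeff]
  simp only [coeff_monomial]
  rw [Finset.sum_ite_eq']
  split_ifs with h
  · rfl
  · rw [Finset.mem_range, not_lt] at h
    exact (charSum_eq_zero χ hR hχ h).symm

theorem LPoly_ne_zero (hR : R.Monic) (hχ : χ ≠ 1) : LPoly χ ≠ 0 := by
  intro h
  have := LPoly_coeff hR hχ 0
  rw [h, charSum_zero] at this
  simp at this

theorem LPoly_eval_zero (hR : R.Monic) (hχ : χ ≠ 1) : (LPoly χ).eval 0 = 1 := by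
  rw [← coeff_zero_eq_eval_zero, LPoly_coeff hR hχ, charSum_zero]

variable (F) in
/-- Monic polynomials, sorted by degree. -/
noncomputable def monicSigma : (Σ n : ℕ, {A : F[X] // A ∈ monicEq F n}) ≃ {A : F[X] // A.Monic} where
  toFun x := ⟨x.2.1, (mem_monicEq.1 x.2.2).1⟩
  invFun A := ⟨A.1.natDegree, ⟨A.1, mem_monicEq.2 ⟨A.2, rfl⟩⟩⟩
  left_inv := by
    rintro ⟨n, A, hA⟩
    obtain ⟨h1, rfl⟩ := mem_monicEq.1 hA
    rfl
  right_inv _ := rfl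

/-- The unit group of the finite quotient ring is finite, so nonzero values of `χ` are roots of
unity. -/
theorem norm_val_le (hR : R.Monic) (A : F[X]) : ‖DirichletChar.val χ A‖ ≤ 1 := by
  have := finite_degreeLT (F := F) R.natDegree
  have := Finite.of_surjective _ (mk_degreeLT_surjective hR le_rfl)
  by_cases h : IsUnit (Ideal.Quotient.mk (Ideal.span {R}) A)
  · obtain ⟨a, ha⟩ := h
    have h1 : DirichletChar.val χ A ^ Nat.card (F[X] ⧸ Ideal.span {R})ˣ = 1 := by
      rw [DirichletChar.val, ← ha, ← map_pow, ← Units.val_pow_eq_pow_val, pow_card_eq_one',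
        Units.val_one, map_one]
    exact (Complex.norm_eq_one_of_pow_eq_one h1 Nat.card_pos.ne').le
  · rw [DirichletChar.val, MulChar.map_nonunit _ h]
    simp

theorem isLFunction_LPoly (hR : R.Monic) (hχ : χ ≠ 1) :
    IsLFunction χ fun s => (LPoly χ).eval (qPow F s) := by
  refine ⟨(LPoly χ).differentiable.comp differentiable_qPow, fun s hs => ?_⟩
  rw [← (monicSigma F).hasSum_iff]
  have hterm (n : ℕ) (A : F[X]) (hA : A ∈ monicEq F n) :
      DirichletChar.val χ A / (absNorm A : ℂ) ^ s = DirichletChar.val χ A * qPow F s ^ n := by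
    obtain ⟨hA', rfl⟩ := mem_monicEq.1 hA
    rw [absNorm_cpow hA'.ne_zero, div_inv_eq_mul, qPow]
  have hq : (1:ℝ) < Fintype.card F := by exact_mod_cast Fintype.one_lt_card
  refine HasSum.sigma_of_hasSum (g := fun n => charSum χ n * qPow F s ^ n) ?_ (fun n => ?_) ?_
  · have h1 : (LPoly χ).eval (qPow F s) =
        ∑ n ∈ Finset.range R.natDegree, charSum χ n * qPow F s ^ n := by
      simp [LPoly, eval_finsetSum]
    simp only [h1]
    refine hasSum_sum_of_ne_finset_zero fun n hn => ?_
    rw [Finset.mem_range, not_lt] at hn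
    rw [charSum_eq_zero χ hR hχ hn, zero_mul]
  · have h1 := (monicEq F n).hasSum fun A => DirichletChar.val χ A / (absNorm A : ℂ) ^ s
    rw [Finset.sum_congr rfl (hterm n), ← Finset.sum_mul] at h1
    exact h1
  · refine Summable.of_norm ((summable_sigma_of_nonneg fun _ => norm_nonneg _).2 ⟨fun n => ?_, ?_⟩)
    · exact (hasSum_fintype _).summable
    -- There are `q^n` monic polynomials of degree `n`, each contributing at most `q^{-n Re s}`; the
    -- comparison ratio `q^{1 - Re s}` is below 1.
    · refine Summable.of_nonneg_of_le (f := fun n : ℕ => ((Fintype.card F : ℝ) ^ (1 - s.re)) ^ n)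
        (fun n => tsum_nonneg fun _ => norm_nonneg _) (fun n => ?_) ?_
      · rw [tsum_fintype]
        have h2 (x : {A : F[X] // A ∈ monicEq F n}) :
            ‖((fun A : {A : F[X] // A.Monic} => DirichletChar.val χ A.1 / (absNorm A.1 : ℂ) ^ s) ∘
              (monicSigma F)) ⟨n, x⟩‖ ≤ ((Fintype.card F : ℝ) ^ (-s.re)) ^ n := by
          have h3 := hterm n x.1 x.2
          simp only [Function.comp_apply, monicSigma, Equiv.coe_fn_mk]
          rw [h3, norm_mul, norm_pow, norm_qPow]
          exact mul_le_of_le_one_left (by positivity) (norm_val_le hR _)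
        refine (Finset.sum_le_sum fun x _ => h2 x).trans (le_of_eq ?_)
        rw [Finset.sum_const, Finset.card_univ, Fintype.card_coe, card_monicEq, nsmul_eq_mul,
          sub_eq_add_neg, Real.rpow_add (by linarith), Real.rpow_one, mul_pow]
        push_cast
        rfl
      · refine summable_geometric_of_lt_one (by positivity) ?_
        exact Real.rpow_lt_one_of_one_lt_of_neg hq (by linarith)

/-- By the identity theorem, agreement on `Re s > 1` determines an entire function. This pins down
the function chosen in `LFunction`. -/
theorem isLFunction_unique {L₁ L₂ : ℂ → ℂ} (h₁ : IsLFunction χ L₁) (h₂ : IsLFunction χ L₂) :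
    L₁ = L₂ := by
  have hA := h₁.1.differentiableOn.analyticOnNhd isOpen_univ
  have hB := h₂.1.differentiableOn.analyticOnNhd isOpen_univ
  refine hA.eq_of_eventuallyEq hB (z₀ := 2) ?_
  filter_upwards [(isOpen_lt continuous_const Complex.continuous_re).mem_nhds
    (show (2:ℂ) ∈ {w : ℂ | 1 < w.re} by simp)] with w hw
  exact (h₁.2 w hw).unique (h₂.2 w hw)

theorem isLFunction_LFunction (hR : R.Monic) (hχ : χ ≠ 1) : IsLFunction χ (LFunction χ) :=
  Classical.epsilon_spec ⟨_, isLFunction_LPoly hR hχ⟩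

theorem LFunction_eq (hR : R.Monic) (hχ : χ ≠ 1) :
    LFunction χ = fun s => (LPoly χ).eval (qPow F s) :=
  isLFunction_unique (isLFunction_LFunction hR hχ) (isLFunction_LPoly hR hχ)

theorem charMangoldtSum_eq (hR : R.Monic) (hχ : χ ≠ 1) {k : ℕ} (hk : k ≠ 0) :
    charMangoldtSum χ k =
      -(Real.log (Fintype.card F) * ((LPoly χ).roots.map fun β => β⁻¹ ^ k).sum) := by
  have hl : (Real.log (Fintype.card F) : ℂ) ≠ 0 := by exact_mod_cast log_card_pos.ne'
  have h := eq_neg_sum_inv_roots_pow (f := LPoly χ)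
    (c := fun k => charMangoldtSum χ k / Real.log (Fintype.card F))
    (by rw [LPoly_coeff hR hχ, charSum_zero]; exact one_ne_zero)
    (fun n => ?_) hk
  · rw [div_eq_iff hl] at h
    rw [h]; ring
  · simp only [LPoly_coeff hR hχ]
    have h1 := natCast_mul_charSum χ n
    have h2 : ∑ p ∈ Finset.HasAntidiagonal.antidiagonal n,
        charMangoldtSum χ p.1 / Real.log (Fintype.card F) * charSum χ p.2 =
        (∑ p ∈ Finset.HasAntidiagonal.antidiagonal n, charMangoldtSum χ p.1 * charSum χ p.2) /
          Real.log (Fintype.card F) := by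
      rw [Finset.sum_div]
      exact Finset.sum_congr rfl fun p _ => by ring
    rw [h2, ← h1]
    field_simp

/-- In degree `n` the factor `Λ(A)/log |A|` becomes `Λ(A)/(n log q)`, and the power sums of the
reciprocal roots replace the sums over polynomials. -/
theorem eulerProd_eq (hR : R.Monic) (hχ : χ ≠ 1) (X : ℕ) (s : ℂ) :
    eulerProd χ X s = Complex.exp (-((LPoly χ).roots.map fun β =>
      ∑ n ∈ Finset.Icc 1 X, (qPow F s / β) ^ n / n).sum) := by
  have hl : (Real.log (Fintype.card F) : ℂ) ≠ 0 := by exact_mod_cast log_card_pos.ne'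
  rw [eulerProd, sum_monicLE]
  congr 1
  have hinner (n : ℕ) : ∑ A ∈ monicEq F n, DirichletChar.val χ A * (vonMangoldt A : ℂ) /
      ((absNorm A : ℂ) ^ s * (Real.log (absNorm A) : ℂ)) =
      charMangoldtSum χ n * (qPow F s ^ n / (n * Real.log (Fintype.card F))) := by
    rw [charMangoldtSum, Finset.sum_mul]
    refine Finset.sum_congr rfl fun A hA => ?_
    obtain ⟨hA', rfl⟩ := mem_monicEq.1 hA
    rw [absNorm_cpow hA'.ne_zero, log_absNorm hA'.ne_zero, ← qPow]
    push_cast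
    rw [div_eq_mul_inv _ (_ * _), mul_inv, inv_inv]
    ring
  rw [Finset.sum_congr rfl fun n _ => hinner n]
  have hrange : Finset.range (X + 1) = insert 0 (Finset.Icc 1 X) := by
    ext n; simp; omega
  rw [hrange, Finset.sum_insert (by simp), charMangoldtSum_zero, zero_mul, zero_add,
    Multiset.sum_map_sum, ← Finset.sum_neg_distrib]
  refine Finset.sum_congr rfl fun n hn => ?_
  have hn0 : n ≠ 0 := by rw [Finset.mem_Icc] at hn; omega
  have hn0' : (n : ℂ) ≠ 0 := by exact_mod_cast hn0
  have h1 : ((LPoly χ).roots.map fun β => (qPow F s / β) ^ n / n).sum =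
      ((LPoly χ).roots.map fun β => β⁻¹ ^ n).sum * (qPow F s ^ n / n) := by
    rw [← Multiset.sum_map_mul_right]
    congr 1
    refine Multiset.map_congr rfl fun β _ => ?_
    rw [div_pow, inv_pow]; ring
  rw [charMangoldtSum_eq hR hχ hn0, h1]
  field_simp

/-- The factorisation of the `L`-function over the roots of its polynomial. -/
theorem LFunction_eq_prod (hR : R.Monic) (hχ : χ ≠ 1) (s : ℂ) :
    LFunction χ s = ((LPoly χ).roots.map fun β => 1 - qPow F s / β).prod := by
  have hsplit : C (LPoly χ).leadingCoeff * ((LPoly χ).roots.map fun β => X - C β).prod = LPoly χ :=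
    C_leadingCoeff_mul_prod_multiset_X_sub_C IsAlgClosed.card_roots_eq_natDegree
  have heval (w : ℂ) : (LPoly χ).eval w =
      (LPoly χ).leadingCoeff * ((LPoly χ).roots.map fun β => w - β).prod := by
    conv_lhs => rw [← hsplit]
    rw [eval_mul, eval_C, eval_multiset_prod, Multiset.map_map]
    simp
  rw [LFunction_eq hR hχ]
  have h1 := heval (qPow F s)
  have h0 := heval 0
  rw [LPoly_eval_zero hR hχ] at h0
  -- The value 1 at `w = 0` says that the leading coefficient times `∏ (0 - β)` is 1, so pulling
  -- `-β` out of each factor removes the constant.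
  have hmap : ((LPoly χ).roots.map fun β => qPow F s - β) =
      (LPoly χ).roots.map fun β => (0 - β) * (1 - qPow F s / β) := by
    refine Multiset.map_congr rfl fun β hβ => ?_
    have hβ0 : β ≠ 0 := by
      rintro rfl
      rw [mem_roots (LPoly_ne_zero hR hχ), IsRoot.def, LPoly_eval_zero hR hχ] at hβ
      exact one_ne_zero hβ
    field_simp
    ring
  change (LPoly χ).eval (qPow F s) = _
  rw [h1, hmap, Multiset.prod_map_mul, ← mul_assoc, ← h0, one_mul]

end LFunction

/-! ### The zeros of the `L`-function and the product over them. -/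

section Zeros

theorem Polynomial.analyticOrderAt_eval {f : ℂ[X]} (hf : f ≠ 0) (β : ℂ) :
    analyticOrderAt (fun w => f.eval w) β = f.rootMultiplicity β := by
  obtain ⟨g, hg, hdvd⟩ := f.exists_eq_pow_rootMultiplicity_mul_and_not_dvd hf β
  have hA : AnalyticAt ℂ (fun w => f.eval w) β := f.differentiable.analyticAt β
  rw [hA.analyticOrderAt_eq_natCast]
  refine ⟨fun w => g.eval w, g.differentiable.analyticAt β, ?_, Filter.Eventually.of_forall ?_⟩
  · rwa [Ne, ← Polynomial.IsRoot.def, ← Polynomial.dvd_iff_isRoot]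
  · intro w
    conv_lhs => rw [hg]
    simp

variable {F : Type*} [Field F] [Fintype F] {R : F[X]} {χ : DirichletChar R}

theorem hasDerivAt_qPow {F : Type*} [Fintype F] (s : ℂ) :
    HasDerivAt (qPow F) (qPow F s * -Real.log (Fintype.card F)) s := by
  have h : HasDerivAt (fun s : ℂ => -(s * Real.log (Fintype.card F)))
      (-(Real.log (Fintype.card F) : ℂ)) s := by
    simpa [Pi.neg_def] using ((hasDerivAt_id s).mul_const (Real.log (Fintype.card F) : ℂ)).neg
  exact h.cexp

/-- The derivative of `q^{-s}` never vanishes, so composition with it preserves orders of vanishing.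
-/
theorem analyticOrderNatAt_LFunction (hR : R.Monic) (hχ : χ ≠ 1) (s : ℂ) :
    analyticOrderNatAt (LFunction χ) s = (LPoly χ).roots.count (qPow F s) := by
  have hcomp : LFunction χ = (fun w => (LPoly χ).eval w) ∘ qPow F := LFunction_eq hR hχ
  have hl : (Real.log (Fintype.card F) : ℂ) ≠ 0 := by exact_mod_cast (log_card_pos (F := F)).ne'
  have hderiv : deriv (qPow F) s ≠ 0 := by
    rw [(hasDerivAt_qPow s).deriv]
    exact mul_ne_zero (qPow_ne_zero s) (neg_ne_zero.2 hl)
  rw [analyticOrderNatAt, hcomp,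
    analyticOrderAt_comp_of_deriv_ne_zero (differentiable_qPow.analyticAt s) hderiv,
    Polynomial.analyticOrderAt_eval (LPoly_ne_zero hR hχ), Polynomial.count_roots]
  rfl

theorem ne_zero_of_mem_LPoly_roots (hR : R.Monic) (hχ : χ ≠ 1) {β : ℂ} (hβ : β ∈ (LPoly χ).roots) :
    β ≠ 0 := by
  rintro rfl
  rw [Polynomial.mem_roots (LPoly_ne_zero hR hχ), Polynomial.IsRoot.def,
    LPoly_eval_zero hR hχ] at hβ
  exact one_ne_zero hβ

/-- The solutions `ρ` of `q ^ (-ρ) = β`. -/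
noncomputable def logLattice (F : Type*) [Fintype F] (β : ℂ) (k : ℤ) : ℂ :=
  -(Complex.log β + k * (2 * Real.pi * Complex.I)) / Real.log (Fintype.card F)

theorem sub_logLattice_mul (s β : ℂ) (k : ℤ) :
    (s - logLattice F β k) * Real.log (Fintype.card F) =
      s * Real.log (Fintype.card F) + Complex.log β + k * (2 * Real.pi * Complex.I) := by
  have hl : (Real.log (Fintype.card F) : ℂ) ≠ 0 := by exact_mod_cast (log_card_pos (F := F)).ne'
  rw [logLattice]
  field_simp
  ring

theorem exp_neg_add_log {F : Type*} [Fintype F] {β : ℂ} (hβ : β ≠ 0) (s : ℂ) :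
    Complex.exp (-(s * Real.log (Fintype.card F) + Complex.log β)) = qPow F s / β := by
  rw [neg_add, ← sub_eq_add_neg, Complex.exp_sub, Complex.exp_log hβ, qPow]

theorem qPow_logLattice {β : ℂ} (hβ : β ≠ 0) (k : ℤ) : qPow F (logLattice F β k) = β := by
  have hl : (Real.log (Fintype.card F) : ℂ) ≠ 0 := by exact_mod_cast (log_card_pos (F := F)).ne'
  have h1 : -(logLattice F β k * Real.log (Fintype.card F)) =
      Complex.log β + k * (2 * Real.pi * Complex.I) := by
    rw [logLattice]; field_simp
  rw [qPow, h1, Complex.exp_periodic.int_mul k, Complex.exp_log hβ]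

/-- The zeros of `L(s, χ)` are the points of finitely many vertical lattices. -/
noncomputable def zeroEquiv (hR : R.Monic) (hχ : χ ≠ 1) :
    {β : ℂ // β ∈ (LPoly χ).roots.toFinset} × ℤ ≃ LZero χ := by
  have hne (β : {β : ℂ // β ∈ (LPoly χ).roots.toFinset}) : β.1 ≠ 0 :=
    ne_zero_of_mem_LPoly_roots hR hχ (Multiset.mem_toFinset.1 β.2)
  have hl : (Real.log (Fintype.card F) : ℂ) ≠ 0 := by exact_mod_cast (log_card_pos (F := F)).ne'
  refine Equiv.ofBijective (fun p => ⟨logLattice F p.1.1 p.2, ?_⟩) ⟨?_, ?_⟩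
  · have h := Multiset.mem_toFinset.1 p.1.2
    rw [Polynomial.mem_roots (LPoly_ne_zero hR hχ), Polynomial.IsRoot.def] at h
    rw [LFunction_eq hR hχ]
    change Polynomial.eval (qPow F _) _ = 0
    rw [qPow_logLattice (hne p.1), h]
  · rintro ⟨β, k⟩ ⟨β', k'⟩ h
    have h : logLattice F β.1 k = logLattice F β'.1 k' := congrArg Subtype.val h
    have hβ : β = β' := Subtype.ext (by
      rw [← qPow_logLattice (F := F) (hne β) k, h, qPow_logLattice (hne β')])
    subst hβ
    have h2 := sub_logLattice_mul (F := F) 0 β.1 k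
    rw [h, sub_logLattice_mul (F := F) 0 β.1 k'] at h2
    have h3 := mul_right_cancel₀ Complex.two_pi_I_ne_zero (add_left_cancel h2)
    rw [Int.cast_injective h3]
  · rintro ⟨ρ, hρ⟩
    rw [LFunction_eq hR hχ] at hρ
    have hβ : qPow F ρ ∈ (LPoly χ).roots.toFinset := by
      rw [Multiset.mem_toFinset, Polynomial.mem_roots (LPoly_ne_zero hR hχ)]
      exact hρ
    have h1 : Complex.exp (Complex.log (qPow F ρ)) =
        Complex.exp (-(ρ * Real.log (Fintype.card F))) := by
      rw [Complex.exp_log (qPow_ne_zero ρ), qPow]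
    obtain ⟨n, hn⟩ := Complex.exp_eq_exp_iff_exists_int.1 h1
    refine ⟨(⟨qPow F ρ, hβ⟩, -n), Subtype.ext ?_⟩
    change logLattice F (qPow F ρ) (-n) = ρ
    rw [logLattice, hn, Int.cast_neg, div_eq_iff hl]
    ring

theorem zeroEquiv_apply_coe (hR : R.Monic) (hχ : χ ≠ 1)
    (p : {β : ℂ // β ∈ (LPoly χ).roots.toFinset} × ℤ) :
    (zeroEquiv hR hχ p : ℂ) = logLattice F p.1.1 p.2 := rfl

theorem mem_slitPlane_of_isRegular {s : ℂ} (hs : IsRegular χ s) (ρ : LZero χ) :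
    s - ρ.1 ∈ Complex.slitPlane :=
  Complex.mem_slitPlane_iff_arg.2 ⟨(hs ρ).2, sub_ne_zero.2 (hs ρ).1⟩

theorem mem_periodicSlitPlane_of_isRegular (hR : R.Monic) (hχ : χ ≠ 1) {s : ℂ}
    (hs : IsRegular χ s) {β : ℂ} (hβ : β ∈ (LPoly χ).roots) :
    s * Real.log (Fintype.card F) + Complex.log β ∈ periodicSlitPlane := by
  refine one_sub_exp_neg_mem_slitPlane_iff.2 fun k => ?_
  rw [← sub_logLattice_mul]
  exact mul_ofReal_mem_slitPlane (mem_slitPlane_of_isRegular hs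
    (zeroEquiv hR hχ (⟨β, Multiset.mem_toFinset.2 hβ⟩, k))) log_card_pos

/-- The regular points are dense. -/
theorem mem_closure_isRegular (hR : R.Monic) (hχ : χ ≠ 1) (s : ℂ) :
    s ∈ closure {s₀ | IsRegular χ s₀} := by
  -- A point on the vertical line through `s` is regular as soon as its height differs from that of
  -- every zero, and only countably many heights are excluded.
  have hcount : Countable (LZero χ) := (zeroEquiv hR hχ).symm.injective.countable
  have hdense : Dense (Set.range fun ρ : LZero χ => ρ.1.im)ᶜ :=
    (Set.countable_range _).dense_compl ℝ
  have hcont : Continuous fun t : ℝ => ((s.re : ℂ) + t * Complex.I) := by fun_prop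
  have h1 := image_closure_subset_closure_image hcont
    (Set.mem_image_of_mem _ (hdense s.im))
  simp only [Complex.re_add_im] at h1
  refine closure_mono ?_ h1
  rintro _ ⟨t, ht, rfl⟩ ρ
  have him : ((s.re : ℂ) + t * Complex.I - ρ.1).im ≠ 0 := by
    simp only [Complex.sub_im, Complex.add_im, Complex.ofReal_im, Complex.mul_im,
      Complex.ofReal_re, Complex.I_im, Complex.I_re, mul_one, mul_zero, zero_add, add_zero]
    exact fun h => ht ⟨ρ, (sub_eq_zero.1 h).symm⟩
  refine ⟨fun h => him (by simp only at h; rw [h]; simp), fun h => him (Complex.arg_eq_pi_iff.1 h).2⟩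

variable {u : ℝ → ℝ} {δ : ℝ} {X : ℕ}

theorem zeroTerm_zeroEquiv (hR : R.Monic) (hχ : χ ≠ 1) (s : ℂ)
    (p : {β : ℂ // β ∈ (LPoly χ).roots.toFinset} × ℤ) :
    zeroTerm χ X u s (zeroEquiv hR hχ p) = ((LPoly χ).roots.count p.1.1 : ℂ) *
      UWeight u ((s * Real.log (Fintype.card F) + Complex.log p.1.1 +
        p.2 * (2 * Real.pi * Complex.I)) * X) := by
  rw [zeroTerm, analyticOrderNatAt_LFunction hR hχ, zeroEquiv_apply_coe, sub_logLattice_mul,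
    qPow_logLattice (ne_zero_of_mem_LPoly_roots hR hχ (Multiset.mem_toFinset.1 p.1.2))]

/-- Regularity of `s` is not needed: on each lattice all but finitely many terms lie off the cut and
obey the inverse square bound. -/
theorem summable_zeroTerm (hu : ContDiff ℝ ∞ u) (hδ : δ ≤ 1)
    (hs : Function.support u ⊆ Set.Icc (Real.exp 1) (Real.exp (1 + δ)))
    (hn : vWeight u 0 = 1) (hX : 1 ≤ X) (hR : R.Monic) (hχ : χ ≠ 1) (s : ℂ) :
    Summable (zeroTerm χ X u s) := by
  rw [← (zeroEquiv hR hχ).summable_iff]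
  refine Summable.of_norm ((summable_prod_of_nonneg fun _ => norm_nonneg _).2
    ⟨fun β => ?_, (hasSum_fintype _).summable⟩)
  simp only [Function.comp_apply, zeroTerm_zeroEquiv]
  exact ((summable_UWeight_translate hu hδ hs hn hX _).mul_left _).norm

/-- Grouping the zeros by `β = q^{-ρ}` turns multiplicities of zeros into multiplicities of roots,
and each lattice sum exponentiates to one factor of `L` times a finite exponential. The right side
is continuous in `s` everywhere, which yields the limits at irregular points. -/
theorem hadamardRaw_eq (hu : ContDiff ℝ ∞ u) (hX : 1 ≤ X) (hδX : δ * X ≤ 1) (hδ : δ ≤ 1)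
    (hs : Function.support u ⊆ Set.Icc (Real.exp 1) (Real.exp (1 + δ)))
    (hn : vWeight u 0 = 1) (hR : R.Monic) (hχ : χ ≠ 1) {s : ℂ} (hreg : IsRegular χ s) :
    hadamardRaw χ X u s = LFunction χ s * Complex.exp ((LPoly χ).roots.map fun β =>
      ∑ n ∈ Finset.Icc 1 X, (qPow F s / β) ^ n / n).sum := by
  have hsum := summable_zeroTerm hu hδ hs hn hX hR hχ s
  set T : ℂ → ℂ := fun β => ∑' k : ℤ, UWeight u ((s * Real.log (Fintype.card F) + Complex.log β +
        k * (2 * Real.pi * Complex.I)) * X) with hT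
  have h1 : ∑' ρ : LZero χ, zeroTerm χ X u s ρ =
      ∑ β ∈ (LPoly χ).roots.toFinset, ((LPoly χ).roots.count β : ℂ) * T β := by
    have hsum' : Summable fun p => zeroTerm χ X u s (zeroEquiv hR hχ p) :=
      (zeroEquiv hR hχ).summable_iff.2 hsum
    rw [← (zeroEquiv hR hχ).tsum_eq, hsum'.tsum_prod, tsum_fintype,
      ← Finset.sum_coe_sort (LPoly χ).roots.toFinset]
    refine Finset.sum_congr rfl fun β _ => ?_
    simp only [zeroTerm_zeroEquiv]
    rw [tsum_mul_left]
  have h2 : hadamardRaw χ X u s =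
      ((LPoly χ).roots.map fun β => Complex.exp (-T β)).prod := by
    rw [hadamardRaw, h1, Finset.prod_multiset_map_count, ← Finset.sum_neg_distrib,
      Complex.exp_sum]
    refine Finset.prod_congr rfl fun β _ => ?_
    rw [← Complex.exp_nat_mul, mul_neg]
  have h3 : ((LPoly χ).roots.map fun β => Complex.exp (-T β)) = (LPoly χ).roots.map fun β =>
      (1 - qPow F s / β) * Complex.exp (∑ n ∈ Finset.Icc 1 X, (qPow F s / β) ^ n / n) := by
    refine Multiset.map_congr rfl fun β hβ => ?_
    rw [hT, exp_neg_tsum_UWeight_translate hu hX hδX hδ hs hn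
      (mem_periodicSlitPlane_of_isRegular hR hχ hreg hβ),
      exp_neg_add_log (ne_zero_of_mem_LPoly_roots hR hχ hβ)]
  rw [h2, h3, Multiset.prod_map_mul, ← LFunction_eq_prod hR hχ, Complex.exp_multiset_sum,
    Multiset.map_map]
  rfl

theorem tendsto_hadamardRaw (hu : ContDiff ℝ ∞ u) (hX : 1 ≤ X) (hδX : δ * X ≤ 1) (hδ : δ ≤ 1)
    (hs : Function.support u ⊆ Set.Icc (Real.exp 1) (Real.exp (1 + δ)))
    (hn : vWeight u 0 = 1) (hR : R.Monic) (hχ : χ ≠ 1) (s : ℂ) :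
    Filter.Tendsto (hadamardRaw χ X u) (𝓝[{s₀ | IsRegular χ s₀}] s)
      (𝓝 (LFunction χ s * Complex.exp ((LPoly χ).roots.map fun β =>
        ∑ n ∈ Finset.Icc 1 X, (qPow F s / β) ^ n / n).sum)) := by
  have hcont : Continuous fun s => LFunction χ s * Complex.exp ((LPoly χ).roots.map fun β =>
        ∑ n ∈ Finset.Icc 1 X, (qPow F s / β) ^ n / n).sum := by
    have h1 := (isLFunction_LFunction hR hχ).1.continuous
    have h2 : Continuous (qPow F) := differentiable_qPow.continuous
    refine h1.mul (Complex.continuous_exp.comp ?_)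
    exact continuous_multiset_sum _ fun β _ => by fun_prop
  refine (hcont.tendsto s).mono_left nhdsWithin_le_nhds |>.congr' ?_
  filter_upwards [self_mem_nhdsWithin] with w hw
  exact (hadamardRaw_eq hu hX hδX hδ hs hn hR hχ hw).symm

theorem neBot_nhdsWithin_isRegular (hR : R.Monic) (hχ : χ ≠ 1) (s : ℂ) :
    (𝓝[{s₀ | IsRegular χ s₀}] s).NeBot :=
  mem_closure_iff_nhdsWithin_neBot.1 (mem_closure_isRegular hR hχ s)

theorem hadamardProd_eq (hu : ContDiff ℝ ∞ u) (hX : 1 ≤ X) (hδX : δ * X ≤ 1) (hδ : δ ≤ 1)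
    (hs : Function.support u ⊆ Set.Icc (Real.exp 1) (Real.exp (1 + δ)))
    (hn : vWeight u 0 = 1) (hR : R.Monic) (hχ : χ ≠ 1) (s : ℂ) :
    hadamardProd χ X u s = LFunction χ s * Complex.exp ((LPoly χ).roots.map fun β =>
      ∑ n ∈ Finset.Icc 1 X, (qPow F s / β) ^ n / n).sum := by
  rw [hadamardProd]
  split_ifs with h
  · exact hadamardRaw_eq hu hX hδX hδ hs hn hR hχ h
  · have := neBot_nhdsWithin_isRegular hR hχ s
    exact (tendsto_hadamardRaw hu hX hδX hδ hs hn hR hχ s).limUnder_eq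

end Zeros

/-! ### The hybrid Euler–Hadamard formula. -/

theorem theorem1 {F : Type*} [Field F] [Fintype F]
    (X : ℕ) (hX : 1 ≤ X)
    (u : ℝ → ℝ) (hu_smooth : ContDiff ℝ ∞ u) (hu_nonneg : ∀ x, 0 ≤ u x)
    (hu_supp : Function.support u ⊆
      Set.Icc (Real.exp 1) (Real.exp (1 + ((Fintype.card F : ℝ) ^ X)⁻¹)))
    (hu_norm : HybridEH.vWeight u 0 = 1)
    (R : F[X]) (hR : R.Monic) (hR1 : R ≠ 1)
    (χ : HybridEH.DirichletChar R) (hχ : HybridEH.DirichletChar.IsPrimitive χ) :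
    -- `L(s, χ)` is the entire continuation of its Dirichlet series
    HybridEH.IsLFunction χ (HybridEH.LFunction χ) ∧
    -- the integrals that define `E₁` and `U` converge absolutely off the branch cut
    (∀ y : ℂ, y ≠ 0 → Complex.arg y ≠ Real.pi →
      MeasureTheory.IntegrableOn (fun t : ℝ => Complex.exp (-(y + t)) / (y + t)) (Set.Ioi 0)) ∧
    (∀ z : ℂ, z ≠ 0 → Complex.arg z ≠ Real.pi →
      MeasureTheory.IntegrableOn
        (fun x : ℝ => (u x : ℂ) * HybridEH.E1 (z * (Real.log x : ℂ))) (Set.Ioi 0)) ∧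
    -- the sum over zeros converges absolutely at every regular point
    (∀ s : ℂ, HybridEH.IsRegular χ s → Summable (HybridEH.zeroTerm χ X u s)) ∧
    -- at every other point the limit that defines `Z_X(s, χ)` makes sense and exists
    (∀ s : ℂ, ¬ HybridEH.IsRegular χ s →
      (𝓝[{s₀ | HybridEH.IsRegular χ s₀}] s).NeBot ∧
      Filter.Tendsto (HybridEH.hadamardRaw χ X u) (𝓝[{s₀ | HybridEH.IsRegular χ s₀}] s)
        (𝓝 (HybridEH.hadamardProd χ X u s))) ∧
    -- the exact formula, for all `s`
    (∀ s : ℂ, HybridEH.LFunction χ s =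
      HybridEH.eulerProd χ X s * HybridEH.hadamardProd χ X u s) := by
  have hcard : (1:ℝ) < Fintype.card F := by exact_mod_cast Fintype.one_lt_card
  have hpow : (1:ℝ) ≤ (Fintype.card F : ℝ) ^ X := one_le_pow₀ hcard.le
  have hδ : ((Fintype.card F : ℝ) ^ X)⁻¹ ≤ 1 := inv_le_one_of_one_le₀ hpow
  -- Here `δ = q^{-X}`, and `X < q^X` makes the rescaled transition range at most 1 long.
  have hδX : ((Fintype.card F : ℝ) ^ X)⁻¹ * X ≤ 1 := by
    rw [inv_mul_le_iff₀ (by linarith), mul_one]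
    exact_mod_cast (Nat.lt_pow_self Fintype.one_lt_card).le
  have hχ1 : χ ≠ 1 := DirichletChar.IsPrimitive.ne_one hχ hR hR1
  refine ⟨isLFunction_LFunction hR hχ1, fun y hy0 hy => ?_, fun z hz0 hz => ?_, fun s _ => ?_,
    fun s _ => ⟨neBot_nhdsWithin_isRegular hR hχ1 s, ?_⟩, fun s => ?_⟩
  · simpa using integrableOn_exp_neg_add_div_pow (Complex.mem_slitPlane_iff_arg.2 ⟨hy, hy0⟩) 1
  · exact integrableOn_weight_mul_E1 hu_smooth.continuous hu_supp
      (Complex.mem_slitPlane_iff_arg.2 ⟨hz, hz0⟩)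
  · exact summable_zeroTerm hu_smooth hδ hu_supp hu_norm hX hR hχ1 s
  · rw [hadamardProd_eq hu_smooth hX hδX hδ hu_supp hu_norm hR hχ1]
    exact tendsto_hadamardRaw hu_smooth hX hδX hδ hu_supp hu_norm hR hχ1 s
  · rw [hadamardProd_eq hu_smooth hX hδX hδ hu_supp hu_norm hR hχ1, eulerProd_eq hR hχ1,
      mul_left_comm, ← Complex.exp_add, neg_add_cancel, Complex.exp_zero, mul_one]
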